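/- Let $F,f:\mathbb R^n\times\mathbb R^m\to\mathbb R$ and $g:\mathbb R^m\to\mathbb R^r$, where $F$ is continuously differentiable, $f$ is twice continuously differentiable in $y$ with $\nabla_y f$ continuously differentiable in $(x,y)$, $g$ is twice continuously differentiable, and $g$ is either affine or componentwise convex with a Slater point ($g(y_0)<0$ for some $y_0$). Put $\Gamma=\{y: g(y)\le 0\}$ and consider $$\text{(MPEC)}\qquad \min_{x,y} F(x,y)\quad\text{s.t.}\quad 0\in\nabla_y f(x,y)+N_\Gamma(y).$$ Notation. $T_\Omega(z)$ is the contingent (Bouligand) cone, $\Omega^\circ$ the polar cone, $\widehat N_\Omega(z)=T_\Omega(z)^\circ$ the regular normal cone, $N_\Omega(z)$ the limiting normal cone (both empty for $z\notin\Omega$), and $\widehat D^*\Phi(x,y)(w)=\{\xi: (\xi,-w)\in\widehat N_{{\rm gph}\,\Phi}(x,y)\}$. For a set $C$, $\mathcal L(C)$ is the largest subspace $L$ with $C+L\subseteq C$. MSCQ at $(\bar x,\bar y)$ means that $\Sigma(\alpha)=\{(x,y): \alpha\in\nabla_y f(x,y)+N_\Gamma(y)\}$ is calm at $(0,(\bar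 x,\bar y))$: there are neighbourhoods $V$ of $0$ and $U$ of $(\bar x,\bar y)$ and $\kappa\ge 0$ with $\Sigma(\alpha)\cap U\subseteq\Sigma(0)+\kappa\|\alpha\|B$ for all $\alpha\in V$, where $B$ is the closed unit ball. Let $P(x,y)=(y,-\nabla_y f(x,y))$. Let $\nabla^2_{yy}f$ be the Hessian in $y$ and $\nabla^2_{xy}f$ the $n\times m$ matrix that is the transpose of the Jacobian of $\nabla_y f$ in $x$. Further let $$\bar\Lambda=\{\lambda: 0=\nabla_y f(\bar x,\bar y)+\nabla g(\bar y)^T\lambda,\ 0\le -g(\bar y)\perp\lambda\ge 0\},\qquad \bar{\mathcal E}=\text{the set of extreme points of }\bar\Lambda,$$ $$\bar K_\Gamma=\{v: \nabla g(\bar y)v\in T_{\mathbb R^r_-}(g(\bar y)),\ \nabla_y f(\bar x,\bar y)^Tv=0\},\qquad \bar\Lambda(v)=\operatorname*{arg\,max}_{\lambda\in\bar\Lambda} v^T\nabla^2(\lambda^Tg)(\bar y)v,$$ $$\bar{\mathcal N}=\{v: \nabla g_i(\bar y)^Tv=0\ \text{ for all } i \text{ with } g_i(\bar y)=0\},$$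 and for $v\in\bar{\mathcal N}$ $$\bar{\mathcal W}(v)=\{w\in\bar K_\Gamma: w^T\nabla^2((\lambda^1-\lambda^2)^Tg)(\bar y)v=0\ \ \forall\lambda^1,\lambda^2\in\bar\Lambda(v)\},$$ $$\tilde\Lambda(v)=\begin{cases}\operatorname{conv}(\bar\Lambda(v)\cap\bar{\mathcal E}) & \text{if } v\ne0,\\ \operatorname{conv}\big(\bigcup_{0\ne u\in\bar K_\Gamma}(\bar\Lambda(u)\cap\bar{\mathcal E})\big) & \text{if } v=0,\ \bar K_\Gamma\ne\{0\},\end{cases}$$ $$\bar L(v;w)=\begin{cases}\{-\nabla^2(\lambda^Tg)(\bar y)w: \lambda\in\tilde\Lambda(v)\}+\bar K_\Gamma^\circ & \text{if }\bar K_\Gamma\ne\{0\},\\ \mathbb R^m & \text{if }\bar K_\Gamma=\{0\}.\end{cases}$$ Theorem. Let $(\bar x,\bar y)$ be a local minimizer of (MPEC) at which MSCQ holds, and suppose that $$\nabla P(\bar x,\bar y)\mathbb R^{n+m}+\mathcal L\big(T_{{\rm gph}\,N_\Gamma}(P(\bar x,\bar y))\big)=\mathbb R^{2m}.$$ Then $(\bar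 x,\bar y)$ is S-stationary: there is $w\in\mathbb R^m$ with $$0=\nabla_xF(\bar x,\bar y)+\nabla^2_{xy}f(\bar x,\bar y)w,\qquad 0\in\nabla_yF(\bar x,\bar y)+\nabla^2_{yy}f(\bar x,\bar y)w+\widehat D^*N_\Gamma(\bar y,-\nabla_yf(\bar x,\bar y))(w).$$ In particular, every such $w$ satisfies $w\in-\bigcap_{v\in\bar{\mathcal N}}\bar{\mathcal W}(v)$ and $$0=\nabla_xF(\bar x,\bar y)+\nabla^2_{xy}f(\bar x,\bar y)w,\qquad 0\in\nabla_yF(\bar x,\bar y)+\nabla^2_{yy}f(\bar x,\bar y)w+\bigcap_{v\in\bar{\mathcal N}}\bar L(v;-w).$$ -/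

import Mathlib

open Set Filter Topology

noncomputable section

namespace Bilevel

/-! ### Variational analysis in Euclidean spaces -/

section VariationalAnalysis

variable {E : Type*} [NormedAddCommGroup E] [InnerProductSpace ℝ E]
variable {E' : Type*} [NormedAddCommGroup E'] [InnerProductSpace ℝ E']

/-- The polar cone `Ω° = {x | ⟪x, v⟫ ≤ 0 for all v ∈ Ω}`. -/
def polar (Ω : Set E) : Set E := {x | ∀ v ∈ Ω, inner ℝ x v ≤ 0}

/-- The (Bouligand-Severi) tangent (contingent) cone `T_Ω(z)`. -/
def tangentCone (Ω : Set E) (z : E) : Set E :=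
  {u | ∃ t : ℕ → ℝ, ∃ u' : ℕ → E, (∀ k, 0 < t k) ∧ Tendsto t atTop (𝓝 0) ∧
    Tendsto u' atTop (𝓝 u) ∧ ∀ k, z + t k • u' k ∈ Ω}

/-- The (Fréchet) regular normal cone: the polar of the tangent cone at points of `Ω`,
and empty at points outside `Ω`. -/
def regularNormalCone (Ω : Set E) (z : E) : Set E :=
  {v | z ∈ Ω ∧ v ∈ polar (tangentCone Ω z)}

/-- The (Mordukhovich) limiting normal cone at points of `Ω`, and empty outside `Ω`. -/
def limitingNormalCone (Ω : Set E) (z : E) : Set E :=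
  {v | z ∈ Ω ∧ ∃ z' : ℕ → E, ∃ v' : ℕ → E, (∀ k, z' k ∈ Ω) ∧ Tendsto z' atTop (𝓝 z) ∧
    Tendsto v' atTop (𝓝 v) ∧ ∀ k, v' k ∈ regularNormalCone Ω (z' k)}

/-- The graph of a set-valued map, as a subset of the product with its Euclidean structure. -/
def gph (Φ : E → Set E') : Set (WithLp 2 (E × E')) := {p | p.snd ∈ Φ p.fst}

/-- The Fréchet (regular) coderivative
`D̂*Φ(x, y)(w) = {ξ | (ξ, -w) ∈ N̂_{gph Φ}(x, y)}`. -/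
def regularCoderivative (Φ : E → Set E') (x : E) (y : E') (w : E') : Set E :=
  {ξ | WithLp.toLp 2 (ξ, -w) ∈ regularNormalCone (gph Φ) (WithLp.toLp 2 (x, y))}

/-- Calmness (pseudo upper-Lipschitz continuity) of a set-valued map `S` at a point
`(a, x)` of its graph: `S(α) ∩ U ⊆ S(a) + κ ‖α - a‖ B` for all `α ∈ V`. -/
def IsCalmAt (S : E → Set E') (a : E) (x : E') : Prop :=
  x ∈ S a ∧ ∃ V ∈ 𝓝 a, ∃ U ∈ 𝓝 x, ∃ κ : ℝ, 0 ≤ κ ∧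
    ∀ α ∈ V, ∀ z ∈ S α ∩ U, ∃ z' ∈ S a, ‖z - z'‖ ≤ κ * ‖α - a‖

/-- The generalized linearity space `𝓛(C)` of an arbitrary set `C`
(see `linearitySpace_isGreatest`). -/
def linearitySpace (C : Set E) : Submodule ℝ E where
  carrier := {l | ∀ a : ℝ, ∀ c ∈ C, c + a • l ∈ C}
  zero_mem' := by
    intro a c hc
    simpa using hc
  add_mem' := by
    intro l₁ l₂ h₁ h₂ a c hc
    have h := h₂ a _ (h₁ a c hc)
    rwa [add_assoc, ← smul_add] at h
  smul_mem' := by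
    intro b l hl a c hc
    rw [smul_smul]
    exact hl _ c hc

/-- `𝓛(C)` is the largest subspace `L` such that `C + L ⊆ C`. -/
theorem linearitySpace_isGreatest (C : Set E) :
    IsGreatest {L : Submodule ℝ E | ∀ c ∈ C, ∀ l ∈ L, c + l ∈ C} (linearitySpace C) := by
  constructor
  · intro c hc l hl
    have h := hl 1 c hc
    rwa [one_smul] at h
  · intro L hL l hl a c hc
    exact hL c hc _ (L.smul_mem a hl)

/-- The Hessian of a real-valued function, as the derivative of its gradient. -/
def hessian [CompleteSpace E] (h : E → ℝ) (y : E) : E →L[ℝ] E := fderiv ℝ (gradient h) y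

end VariationalAnalysis

/-- `ℝⁿ` with its Euclidean structure. -/
abbrev Euc (n : ℕ) : Type := EuclideanSpace ℝ (Fin n)

/-- `ℝ^{n+m} = ℝⁿ × ℝᵐ` with its Euclidean structure. -/
abbrev Euc₂ (n m : ℕ) : Type := WithLp 2 (Euc n × Euc m)

section Problem

variable {n m r : ℕ}

/-- `∇_y f(x, y)`. -/
def gradY (f : Euc n → Euc m → ℝ) (x : Euc n) (y : Euc m) : Euc m :=
  gradient (fun y' => f x y') y

/-- `∇_x F(x, y)`. -/
def gradX (F : Euc n → Euc m → ℝ) (x : Euc n) (y : Euc m) : Euc n :=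
  gradient (fun x' => F x' y) x

/-- `∇²_{xy} f(x, y)`, the `n × m` matrix that is the transpose of the Jacobian
of `∇_y f` with respect to `x`. -/
def hessXY (f : Euc n → Euc m → ℝ) (x : Euc n) (y : Euc m) : Euc m →L[ℝ] Euc n :=
  ContinuousLinearMap.adjoint (fderiv ℝ (fun x' => gradY f x' y) x)

/-- `∇²_{yy} f(x, y)`. -/
def hessYY (f : Euc n → Euc m → ℝ) (x : Euc n) (y : Euc m) : Euc m →L[ℝ] Euc m :=
  hessian (fun y' => f x y') y

/-- The lower level feasible set `Γ = {y | g(y) ≤ 0}`. -/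
def lowerFeasible (g : Euc m → Euc r) : Set (Euc m) := {y | ∀ i, g y i ≤ 0}

/-- The standing assumption on the lower level constraints: `g` is affine, or it is convex
and has a Slater point. -/
def AffineOrSlater (g : Euc m → Euc r) : Prop :=
  (∃ A : Euc m →ᵃ[ℝ] Euc r, ∀ y, g y = A y) ∨
    ((∀ i, ConvexOn ℝ univ (fun y => g y i)) ∧ ∃ y, ∀ i, g y i < 0)

/-- The perturbed feasible solution map `Σ(α) = {(x, y) | α ∈ ∇_y f(x, y) + N_Γ(y)}`. -/
def perturbedFeasible (f : Euc n → Euc m → ℝ) (g : Euc m → Euc r) (α : Euc m) :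
    Set (Euc₂ n m) :=
  {z | ∃ ν ∈ limitingNormalCone (lowerFeasible g) z.snd, α = gradY f z.fst z.snd + ν}

/-- `(x, y)` is a local minimizer of
(MPEC): minimize `F(x, y)` subject to `0 ∈ ∇_y f(x, y) + N_Γ(y)`. -/
def IsLocalMinimizerMPEC (F f : Euc n → Euc m → ℝ) (g : Euc m → Euc r)
    (x : Euc n) (y : Euc m) : Prop :=
  WithLp.toLp 2 (x, y) ∈ perturbedFeasible f g 0 ∧
    IsLocalMinOn (fun z : Euc₂ n m => F z.fst z.snd) (perturbedFeasible f g 0)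
      (WithLp.toLp 2 (x, y))

/-- The metric subregularity constraint qualification for (MPEC) at `(x, y)`:
calmness of the perturbed feasible solution map at `(0, (x, y))`. -/
def MSCQ (f : Euc n → Euc m → ℝ) (g : Euc m → Euc r) (x : Euc n) (y : Euc m) : Prop :=
  IsCalmAt (perturbedFeasible f g) 0 (WithLp.toLp 2 (x, y))

/-- `P(x, y) = (y, -∇_y f(x, y))`. -/
def mapP (f : Euc n → Euc m → ℝ) (z : Euc₂ n m) : Euc₂ m m :=
  WithLp.toLp 2 (z.snd, -gradY f z.fst z.snd)

/-- The generalized LICQ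
`∇P(x, y) ℝ^{n+m} + 𝓛(T_{gph N_Γ}(P(x, y))) = ℝ^{2m}`. -/
def GeneralizedLICQ (f : Euc n → Euc m → ℝ) (g : Euc m → Euc r)
    (x : Euc n) (y : Euc m) : Prop :=
  LinearMap.range (fderiv ℝ (mapP f) (WithLp.toLp 2 (x, y))).toLinearMap ⊔
    linearitySpace (tangentCone (gph (limitingNormalCone (lowerFeasible g)))
      (mapP f (WithLp.toLp 2 (x, y)))) = ⊤

/-- `w` satisfies the S-stationarity system of (MPEC) at `(x, y)`:
`0 = ∇_x F + ∇²_{xy} f w` and `0 ∈ ∇_y F + ∇²_{yy} f w + D̂*N_Γ(y, -∇_y f)(w)`. -/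
def SStationaryWith (F f : Euc n → Euc m → ℝ) (g : Euc m → Euc r)
    (x : Euc n) (y : Euc m) (w : Euc m) : Prop :=
  0 = gradX F x y + hessXY f x y w ∧
    ∃ ξ ∈ regularCoderivative (limitingNormalCone (lowerFeasible g)) y (-gradY f x y) w,
      0 = gradY F x y + hessYY f x y w + ξ

/-- The lower level multiplier set `Λ̄`. -/
def multipliers (f : Euc n → Euc m → ℝ) (g : Euc m → Euc r) (x : Euc n) (y : Euc m) :
    Set (Euc r) :=
  {l | 0 = gradY f x y + ContinuousLinearMap.adjoint (fderiv ℝ g y) l ∧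
    (∀ i, 0 ≤ l i) ∧ (∀ i, 0 ≤ -(g y i)) ∧ inner ℝ (-(g y)) l = 0}

/-- The critical cone `K̄_Γ`. -/
def criticalCone (f : Euc n → Euc m → ℝ) (g : Euc m → Euc r) (x : Euc n) (y : Euc m) :
    Set (Euc m) :=
  {v | fderiv ℝ g y v ∈ tangentCone {u : Euc r | ∀ i, u i ≤ 0} (g y) ∧
    inner ℝ (gradY f x y) v = 0}

/-- `∇²(lᵀg)(y)`. -/
def hessG (g : Euc m → Euc r) (l : Euc r) (y : Euc m) : Euc m →L[ℝ] Euc m :=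
  hessian (fun y' => inner ℝ l (g y')) y

/-- The directional multiplier set
`Λ̄(v) = argmax {vᵀ ∇²(λᵀg)(y) v | λ ∈ Λ̄}`. -/
def dirMultipliers (f : Euc n → Euc m → ℝ) (g : Euc m → Euc r) (x : Euc n) (y : Euc m)
    (v : Euc m) : Set (Euc r) :=
  {l | l ∈ multipliers f g x y ∧
    IsMaxOn (fun l' => inner ℝ v (hessG g l' y v)) (multipliers f g x y) l}

/-- The set `Ē` of extreme points of `Λ̄`. -/
def extremeMultipliers (f : Euc n → Euc m → ℝ) (g : Euc m → Euc r)
    (x : Euc n) (y : Euc m) : Set (Euc r) :=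
  extremePoints ℝ (multipliers f g x y)

/-- `𝒩̄ = {v | ∇g_i(y)ᵀ v = 0 for all active i}`. -/
def activeNullspace (g : Euc m → Euc r) (y : Euc m) : Set (Euc m) :=
  {v | ∀ i, g y i = 0 → inner ℝ (gradient (fun y' => g y' i) y) v = 0}

/-- `𝒲̄(v)`. -/
def setW (f : Euc n → Euc m → ℝ) (g : Euc m → Euc r) (x : Euc n) (y : Euc m)
    (v : Euc m) : Set (Euc m) :=
  {w | w ∈ criticalCone f g x y ∧
    ∀ l₁ ∈ dirMultipliers f g x y v, ∀ l₂ ∈ dirMultipliers f g x y v,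
      inner ℝ w (hessG g (l₁ - l₂) y v) = 0}

open Classical in
/-- `Λ̃(v)`: the convex hull of `Λ̄(v) ∩ Ē` if `v ≠ 0`, and the convex hull of the union of
the sets `Λ̄(u) ∩ Ē`, `0 ≠ u ∈ K̄_Γ`, if `v = 0`. (It is used only if `K̄_Γ ≠ {0}`.) -/
def tildeMultipliers (f : Euc n → Euc m → ℝ) (g : Euc m → Euc r) (x : Euc n) (y : Euc m)
    (v : Euc m) : Set (Euc r) :=
  if v ≠ 0 then
    convexHull ℝ (dirMultipliers f g x y v ∩ extremeMultipliers f g x y)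
  else
    convexHull ℝ (⋃ u ∈ {u | u ∈ criticalCone f g x y ∧ u ≠ 0},
      dirMultipliers f g x y u ∩ extremeMultipliers f g x y)

open Classical in
/-- `L̄(v; w)`: equal to `{-∇²(λᵀg)(y) w | λ ∈ Λ̃(v)} + K̄_Γ°` if `K̄_Γ ≠ {0}`, and to `ℝᵐ`
if `K̄_Γ = {0}`. -/
def setL (f : Euc n → Euc m → ℝ) (g : Euc m → Euc r) (x : Euc n) (y : Euc m)
    (v w : Euc m) : Set (Euc m) :=
  if criticalCone f g x y ≠ {0} then
    {ξ | ∃ l ∈ tildeMultipliers f g x y v, ∃ k ∈ polar (criticalCone f g x y),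
      ξ = -(hessG g l y w) + k}
  else univ

end Problem

end Bilevel

end

open Bilevel

/-! The existence of `w` is a multiplier argument. A direction that the linearization of `mapP`
sends into the tangent cone `T` of `gph N_Γ` nearly solves the generalized equation, with residual
`o(t)`. Calmness corrects it within `o(t)`, so it is tangent to the feasible set, and `F` does not
decrease along it to first order. The generalized LICQ then turns this inequality into an element `η
= (ξ, -w)` of the polar of `T` that solves the adjoint equation. No convexity of `T` is needed
(`exists_mem_polar_of_range_sup_linearitySpace`).

The explicit bounds need enough tangents to `gph N_Γ`. For critical `v`, `λ ∈ Λ̄(v)` and `u ∈ K̄_Γ°`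
with `u ⊥ v`, the pair `(v, ∇²(λᵀg)v + u)` is tangent (`mem_tangentCone_gph`). To see this, put `d =
v + ∇²(λᵀg)v + u` and project `y - ∇_y f + t d` onto `Γ`. The difference quotients of the
projections have a cluster point whose energy `w ↦ wᵀ∇²(λᵀg)w + ‖d - w‖²` does not exceed that of
`v`. The bound combines a Lagrangian estimate from below with feasible parabolic arcs and linear
programming duality from above. Since `v` is the unique minimizer of this energy over the critical
cone, the cluster point is `v`.

Let `(ξ, ω)`, with `ω = -w`, be a regular normal. Pairing it with these tangents gives linear
inequalities. Taking `v = 0` yields `ω ∈ K̄_Γ°° = K̄_Γ`. For `v` in the subspace `𝒩̄`, using `±v`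
yields equality, hence `ω ∈ 𝒲̄(v)`. Perturbing `v` towards a critical `u`, and using that `Λ̄` has
finitely many extreme points, yields for each `u` an extreme multiplier of `v` satisfying the
inequality at `u`. Separating a polytope from `K̄_Γ°` replaces these by one multiplier in the convex
hull, which is membership in `L̄(v; ω)`. -/

noncomputable section

namespace Bilevel

/-! ### Theorem of the alternative for finitely many linear functionals. -/

section Farkas

variable {V : Type*} [AddCommGroup V] [Module ℝ V]

/-- The Farkas lemma for finitely many linear functionals. -/
theorem farkas {ι : Type*} [DecidableEq ι] (s : Finset ι) :
    ∀ (a : ι → V →ₗ[ℝ] ℝ) (b : V →ₗ[ℝ] ℝ),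
      (∀ x, (∀ i ∈ s, a i x ≤ 0) → b x ≤ 0) →
      ∃ c : ι → ℝ, (∀ i, 0 ≤ c i) ∧ b = ∑ i ∈ s, c i • a i := by
  induction s using Finset.induction_on with
  | empty =>
    intro a b h
    refine ⟨0, fun _ => le_rfl, ?_⟩
    ext x
    have h₁ := h x (by simp)
    have h₂ := h (-x) (by simp)
    simp only [map_neg] at h₂
    simp
    linarith
  | insert j s hj ih =>
    intro a b h
    by_cases hs : ∀ x, (∀ i ∈ s, a i x ≤ 0) → b x ≤ 0
    · obtain ⟨c, hc, hb⟩ := ih a b hs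
      refine ⟨Function.update c j 0, fun i => ?_, ?_⟩
      · by_cases hi : i = j
        · subst hi; simp
        · simp [hi, hc]
      · rw [Finset.sum_insert hj, hb]
        simp only [Function.update_self, zero_smul, zero_add]
        refine Finset.sum_congr rfl fun i hi => ?_
        rw [Function.update_of_ne (ne_of_mem_of_not_mem hi hj)]
    -- If the `j`-th inequality is indispensable, the violating `x₀` has `a j x₀ > 0`. Projecting
    -- along `x₀` onto the kernel of `a j` eliminates that inequality.
    · push Not at hs
      obtain ⟨x₀, hx₀, hbx₀⟩ := hs
      have hj₀ : 0 < a j x₀ := by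
        by_contra hcon
        refine absurd (h x₀ fun i hi => ?_) (not_le.2 hbx₀)
        rcases Finset.mem_insert.1 hi with rfl | hi
        · exact not_lt.1 hcon
        · exact hx₀ i hi
      obtain ⟨c, hc, hb⟩ := ih (fun i => a i - (a i x₀ / a j x₀) • a j)
        (b - (b x₀ / a j x₀) • a j) (fun x hx => by
          have hy : ∀ L : V →ₗ[ℝ] ℝ, L (x - (a j x / a j x₀) • x₀)
              = (L - (L x₀ / a j x₀) • a j) x := by
            intro L
            simp only [map_sub, map_smul, smul_eq_mul, LinearMap.sub_apply, LinearMap.smul_apply]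
            ring
          rw [← hy b]
          apply h
          intro i hi
          rw [hy]
          rcases Finset.mem_insert.1 hi with rfl | hi
          · simp [div_self hj₀.ne']
          · exact hx i hi)
      refine ⟨Function.update c j (b x₀ / a j x₀ - ∑ i ∈ s, c i * (a i x₀ / a j x₀)),
        fun i => ?_, ?_⟩
      · by_cases hi : i = j
        · subst hi
          simp only [Function.update_self]
          have : ∑ k ∈ s, c k * (a k x₀ / a i x₀) ≤ 0 :=
            Finset.sum_nonpos fun k hk => mul_nonpos_of_nonneg_of_nonpos (hc k)
              (div_nonpos_of_nonpos_of_nonneg (hx₀ k hk) hj₀.le)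
          have : 0 ≤ b x₀ / a i x₀ := (div_pos hbx₀ hj₀).le
          linarith
        · simp [hi, hc]
      · rw [Finset.sum_insert hj]
        simp only [Function.update_self]
        have : ∑ i ∈ s, Function.update c j
            (b x₀ / a j x₀ - ∑ i ∈ s, c i * (a i x₀ / a j x₀)) i • a i = ∑ i ∈ s, c i • a i :=
          Finset.sum_congr rfl fun i hi => by
            rw [Function.update_of_ne (ne_of_mem_of_not_mem hi hj)]
        rw [this]
        ext x
        have hbx := LinearMap.congr_fun hb x
        simp only [LinearMap.sub_apply, LinearMap.smul_apply, LinearMap.sum_apply, smul_eq_mul,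
          mul_sub, Finset.sum_sub_distrib, ← mul_assoc, ← Finset.sum_mul] at hbx
        simp only [LinearMap.add_apply, LinearMap.smul_apply, LinearMap.sum_apply, smul_eq_mul,
          sub_mul]
        linarith

end Farkas

/-! ### Extreme points of polyhedra in standard form. -/

section Polyhedron

variable {r : ℕ} {W : Type*} [AddCommGroup W] [Module ℝ W]

/-- The polyhedron `{l | T l = b, l ≥ 0}` in standard form. -/
def stdPolyhedron (T : Euc r →ₗ[ℝ] W) (b : W) : Set (Euc r) := {l | T l = b ∧ ∀ i, 0 ≤ l i}

variable {T : Euc r →ₗ[ℝ] W} {b : W}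

theorem exists_small_step (l d : Euc r) (hl : ∀ i, 0 ≤ l i) (hd : ∀ i, l i = 0 → d i = 0) :
    ∃ ε > 0, ∀ i, 0 ≤ l i + ε * d i := by
  have h : ∀ᶠ ε : ℝ in 𝓝[>] 0, ∀ i, 0 ≤ l i + ε * d i := by
    refine eventually_all.2 fun i => ?_
    rcases (hl i).eq_or_lt with h0 | h0
    · simp [← h0, hd i h0.symm]
    · have : Tendsto (fun ε : ℝ => l i + ε * d i) (𝓝[>] 0) (𝓝 (l i + 0 * d i)) :=
        tendsto_nhdsWithin_of_tendsto_nhds (Continuous.tendsto (by fun_prop) 0)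
      rw [zero_mul, add_zero] at this
      exact (this.eventually (lt_mem_nhds h0)).mono fun _ h => h.le
  obtain ⟨ε, hε, h0⟩ := (h.and self_mem_nhdsWithin).exists
  exact ⟨ε, h0, hε⟩

/-- If the support of `l'` lies in that of `l`, the segment from `l'` to `l` can be prolonged a
little beyond `l` inside the polyhedron, so `l` is interior to a segment unless `l' = l`. -/
theorem eq_of_mem_extremePoints_of_support {l l' : Euc r}
    (hl : l ∈ extremePoints ℝ (stdPolyhedron T b)) (hl' : l' ∈ stdPolyhedron T b)
    (h : ∀ i, l i = 0 → l' i = 0) : l' = l := by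
  have hlS := hl.1
  obtain ⟨ε, hε, hpos⟩ := exists_small_step l (l - l') hlS.2 fun i hi => by simp [hi, h i hi]
  have h₁ : l + ε • (l - l') ∈ stdPolyhedron T b :=
    ⟨by simp [hlS.1, hl'.1], fun i => by simpa using hpos i⟩
  refine hl.2 hl' h₁ ⟨ε / (1 + ε), 1 / (1 + ε), by positivity, by positivity,
    by field_simp; ring, ?_⟩
  rw [smul_add, smul_smul, smul_sub]
  have e : (1 / (1 + ε)) * ε = ε / (1 + ε) := by ring
  rw [e]
  have e2 : l = (1 / (1 + ε) + ε / (1 + ε)) • l := by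
    rw [← add_div, div_self (by positivity), one_smul]
  conv_rhs => rw [e2]
  rw [add_smul]
  abel

/-- An extreme point is determined by its zero set, and there are finitely many of those. -/
theorem finite_extremePoints_stdPolyhedron :
    (extremePoints ℝ (stdPolyhedron T b)).Finite := by
  classical
  refine Set.Finite.of_injOn (f := fun l : Euc r => Finset.univ.filter fun i => l i = 0)
    (t := univ) (fun _ _ => mem_univ _) ?_ Set.finite_univ
  intro l hl l' hl' h
  refine (eq_of_mem_extremePoints_of_support hl hl'.1 fun i hi => ?_).symm
  have := congrArg (fun s => i ∈ s) h
  simpa [hi] using this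

/-- The ratio test of the simplex method: the first coordinate to reach zero along `d` gives a point
with smaller support. -/
theorem exists_ratio_step (l d : Euc r) (hl : ∀ i, 0 ≤ l i) (hd : ∀ i, l i = 0 → d i = 0)
    (hneg : ∃ i, d i < 0) :
    ∃ t : ℝ, 0 ≤ t ∧ (∀ i, 0 ≤ l i + t * d i) ∧ ∃ j, l j ≠ 0 ∧ l j + t * d j = 0 := by
  classical
  obtain ⟨j, hj, hmin⟩ := (Finset.univ.filter fun i => d i < 0).exists_min_image
    (fun i => l i / (-d i)) (by obtain ⟨i, hi⟩ := hneg; exact ⟨i, by simpa using hi⟩)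
  have hj : d j < 0 := by simpa using hj
  have ht : 0 ≤ l j / (-d j) := div_nonneg (hl j) (by linarith)
  refine ⟨l j / (-d j), ht, fun i => ?_, j, fun h0 => hj.ne (hd j h0), ?_⟩
  · rcases le_or_gt 0 (d i) with hi | hi
    · have := hl i; positivity
    · have := hmin i (by simpa using hi)
      rw [le_div_iff₀ (by linarith)] at this
      linarith
  · have : d j ≠ 0 := hj.ne
    field_simp
    ring

/-- Every point of a polyhedron in standard form is dominated by an extreme point, with respect to
a linear objective which is bounded above on the polyhedron. -/
theorem exists_extremePoint_ge (c : Euc r →ₗ[ℝ] ℝ) {M : ℝ}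
    (hM : ∀ l ∈ stdPolyhedron T b, c l ≤ M) :
    ∀ l ∈ stdPolyhedron T b, ∃ l' ∈ extremePoints ℝ (stdPolyhedron T b), c l ≤ c l' := by
  classical
  suffices H : ∀ k : ℕ, ∀ l ∈ stdPolyhedron T b,
      (Finset.univ.filter fun i => l i ≠ 0).card = k →
      ∃ l' ∈ extremePoints ℝ (stdPolyhedron T b), c l ≤ c l' from fun l hl => H _ l hl rfl
  intro k
  induction k using Nat.strong_induction_on with
  | _ k ih =>
  intro l hl hk
  by_cases hext : l ∈ extremePoints ℝ (stdPolyhedron T b)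
  · exact ⟨l, hext, le_rfl⟩
  have step : ∀ d : Euc r, T d = 0 → (∀ i, l i = 0 → d i = 0) → 0 ≤ c d → (∃ i, d i < 0) →
      ∃ l' ∈ extremePoints ℝ (stdPolyhedron T b), c l ≤ c l' := by
    intro d hTd hd hcd hneg
    obtain ⟨t, ht, hpos, j, hj, hj0⟩ := exists_ratio_step l d hl.2 hd hneg
    have hmem : l + t • d ∈ stdPolyhedron T b :=
      ⟨by simp [hl.1, hTd], fun i => by simpa using hpos i⟩
    have hlt : (Finset.univ.filter fun i => (l + t • d) i ≠ 0).card < k := by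
      rw [← hk]
      refine Finset.card_lt_card ((Finset.ssubset_iff_of_subset fun i hi => ?_).2
        ⟨j, by simpa using hj, fun hm =>
          (Finset.mem_filter.1 hm).2 (by simpa using hj0)⟩)
      simp only [Finset.mem_filter, Finset.mem_univ, true_and] at hi ⊢
      intro h0
      exact hi (by simp [h0, hd i h0])
    obtain ⟨l', hl', hcl'⟩ := ih _ hlt _ hmem rfl
    refine ⟨l', hl', le_trans ?_ hcl'⟩
    rw [map_add, map_smul, smul_eq_mul]
    nlinarith [mul_nonneg ht hcd]
  -- The difference of the endpoints of a segment through `l` is a direction in the kernel of `T`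
  -- supported where `l` is: two nonnegative terms with zero sum both vanish.
  obtain ⟨d, hd0, hTd, hd⟩ : ∃ d : Euc r, d ≠ 0 ∧ T d = 0 ∧ ∀ i, l i = 0 → d i = 0 := by
    rw [mem_extremePoints] at hext
    push Not at hext
    obtain ⟨x₁, hx₁, x₂, hx₂, ⟨α, β, hα, hβ, hαβ, hx⟩, hne⟩ := hext hl
    refine ⟨x₁ - x₂, fun h => ?_, by simp [hx₁.1, hx₂.1], fun i hi => ?_⟩
    · have h12 : x₁ = x₂ := sub_eq_zero.1 h
      have h1 : x₁ = l := by rw [← hx, ← h12, ← add_smul, hαβ, one_smul]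
      exact hne h1 (h12 ▸ h1)
    · have hi' : α * x₁ i + β * x₂ i = 0 := by rw [← hi, ← hx]; simp
      have h1 := hx₁.2 i
      have h2 := hx₂.2 i
      have h1' : x₁ i = 0 := by
        have : α * x₁ i = 0 := by nlinarith [mul_nonneg hα.le h1, mul_nonneg hβ.le h2]
        exact (mul_eq_zero.1 this).resolve_left hα.ne'
      have h2' : x₂ i = 0 := by
        have : β * x₂ i = 0 := by nlinarith [mul_nonneg hα.le h1, mul_nonneg hβ.le h2]
        exact (mul_eq_zero.1 this).resolve_left hβ.ne'
      simp [h1', h2']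
  wlog hcd : 0 ≤ c d generalizing d
  · exact this (-d) (neg_ne_zero.2 hd0) (by simp [hTd]) (fun i hi => by simp [hd i hi])
      (by rw [map_neg]; linarith [not_le.1 hcd])
  by_cases hneg : ∃ i, d i < 0
  · exact step d hTd hd hcd hneg
  push Not at hneg
  -- Here `d` is a recession direction, so `c d > 0` would push the objective beyond `M`. Thus `-d`
  -- loses nothing, and it has a negative coordinate.
  have hcd0 : c d = 0 := by
    refine le_antisymm ?_ hcd
    by_contra hpos
    have hpos := not_le.1 hpos
    have ht : 0 ≤ (M - c l) / c d + 1 := by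
      have := hM l hl
      have : 0 ≤ (M - c l) / c d := div_nonneg (by linarith) hpos.le
      linarith
    have := hM (l + ((M - c l) / c d + 1) • d) ⟨by simp [hl.1, hTd], fun i => by
      have h1 := hl.2 i
      have h2 := mul_nonneg ht (hneg i)
      simpa using add_nonneg h1 h2⟩
    rw [map_add, map_smul, smul_eq_mul, add_mul, div_mul_cancel₀ _ hpos.ne'] at this
    linarith
  refine step (-d) (by simp [hTd]) (fun i hi => by simp [hd i hi]) (by simp [hcd0]) ?_
  by_contra hcon
  push Not at hcon
  refine hd0 ?_
  ext i
  have h1 := hneg i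
  have h2 := hcon i
  simp only [PiLp.neg_apply] at h2
  simp only [PiLp.zero_apply]
  linarith

end Polyhedron

/-! ### Second order expansions. -/

section Taylor

variable {E E' : Type*} [NormedAddCommGroup E] [NormedSpace ℝ E]
  [NormedAddCommGroup E'] [NormedSpace ℝ E']

/-- Second order Taylor expansion. -/
theorem isLittleO_taylor_two {g : E → E'} (hg : ContDiff ℝ 2 g) (y : E) :
    (fun h => g (y + h) - g y - fderiv ℝ g y h - (1 / 2 : ℝ) • fderiv ℝ (fderiv ℝ g) y h h)
      =o[𝓝 0] fun h => ‖h‖ ^ 2 := by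
  set A := fderiv ℝ g y
  set Q := fderiv ℝ (fderiv ℝ g) y with hQ
  have hsym : ∀ u v, Q u v = Q v u := fun u v =>
    (hg.contDiffAt.isSymmSndFDerivAt (by simp)) u v
  have hR : ∀ h, HasFDerivAt
      (fun h => g (y + h) - g y - A h - (1 / 2 : ℝ) • Q h h)
      (fderiv ℝ g (y + h) - A - Q h) h := by
    intro h
    have h1 : HasFDerivAt (fun h => g (y + h)) (fderiv ℝ g (y + h)) h := by
      have hd : HasFDerivAt g (fderiv ℝ g (y + h)) (y + h) :=
        ((hg.differentiable (by norm_num)) (y + h)).hasFDerivAt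
      exact (hd.comp h ((hasFDerivAt_id h).const_add y) :)
    have h2 : HasFDerivAt (fun h => Q h h) (Q h + Q.flip h) h := by
      have := (Q.hasFDerivAt (x := h)).clm_apply (hasFDerivAt_id h)
      simpa using this
    have e : fderiv ℝ g (y + h) - A - Q h
        = fderiv ℝ g (y + h) - A - (1 / 2 : ℝ) • (Q h + Q.flip h) := by
      ext k
      simp only [sub_apply, smul_apply, add_apply, ContinuousLinearMap.flip_apply, hsym k h,
        ← two_smul ℝ, smul_smul]
      norm_num
    rw [e]
    exact ((h1.sub_const (g y)).sub A.hasFDerivAt).sub (h2.const_smul (1 / 2 : ℝ))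
  have hlo : (fun h => fderiv ℝ g (y + h) - A - Q h) =o[𝓝 0] fun h => h := by
    have hd : HasFDerivAt (fderiv ℝ g) Q y :=
      (((hg.fderiv_right (m := 1) (by norm_num)).differentiable (by norm_num)) y).hasFDerivAt
    exact hasFDerivAt_iff_isLittleO_nhds_zero.1 hd
  rw [Asymptotics.isLittleO_iff]
  intro c hc
  obtain ⟨δ, hδ, hball⟩ := Metric.eventually_nhds_iff_ball.1 (hlo.bound hc)
  filter_upwards [Metric.ball_mem_nhds (0 : E) hδ] with h hh
  have hsub : ∀ k ∈ segment ℝ 0 h, ‖k‖ ≤ ‖h‖ := by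
    rintro k ⟨a, b, ha, hb, hab, rfl⟩
    rw [smul_zero, zero_add, norm_smul, Real.norm_of_nonneg hb]
    exact mul_le_of_le_one_left (norm_nonneg _) (by linarith)
  -- Mean value inequality for the remainder, whose derivative is at most `c * ‖h‖` in norm along
  -- the segment from `0` to `h`.
  have := (convex_segment (0 : E) h).norm_image_sub_le_of_norm_hasFDerivWithin_le
    (f := fun h => g (y + h) - g y - A h - (1 / 2 : ℝ) • Q h h) (C := c * ‖h‖)
    (fun k _ => (hR k).hasFDerivWithinAt) (fun k hk => by
      have hk' := hsub k hk
      refine (hball k ?_).trans (by gcongr)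
      rw [mem_ball_zero_iff] at hh ⊢
      exact hk'.trans_lt hh) (left_mem_segment ℝ _ _) (right_mem_segment ℝ _ _)
  simp only [add_zero, map_zero, sub_self, smul_zero,
    sub_zero] at this
  rw [norm_pow, norm_norm]
  linarith [this, sq ‖h‖]

/-- The direction may vary with `t`. This serves both the parabolic arcs and the difference
quotients of projections. -/
theorem tendsto_second_order_quotient {g : E → E'} (hg : ContDiff ℝ 2 g) (y : E)
    {α : Type*} {l : Filter α} {t : α → ℝ} {V : α → E} {v : E}
    (ht : Tendsto t l (𝓝[>] 0)) (hV : Tendsto V l (𝓝 v)) :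
    Tendsto (fun k => (t k ^ 2)⁻¹ • (g (y + t k • V k) - g y - t k • fderiv ℝ g y (V k))) l
      (𝓝 ((1 / 2 : ℝ) • fderiv ℝ (fderiv ℝ g) y v v)) := by
  set Q := fderiv ℝ (fderiv ℝ g) y
  have ht0 : Tendsto t l (𝓝 0) := ht.mono_right nhdsWithin_le_nhds
  have hpos : ∀ᶠ k in l, 0 < t k := ht.eventually self_mem_nhdsWithin
  have hh : Tendsto (fun k => t k • V k) l (𝓝 0) := by simpa using ht0.smul hV
  have h1 := (isLittleO_taylor_two hg y).comp_tendsto hh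
  have h2 : ((fun h : E => ‖h‖ ^ 2) ∘ fun k => t k • V k) =O[l] fun k => t k ^ 2 := by
    have h3 : (fun k => t k • V k) =O[l] fun k => t k * 1 :=
      (Asymptotics.isBigO_refl t l).smul (hV.isBigO_one ℝ)
    simp only [mul_one] at h3
    exact h3.norm_left.pow 2
  have h4 := (h1.trans_isBigO h2).tendsto_inv_smul_nhds_zero
  have h5 : Tendsto (fun k => (1 / 2 : ℝ) • Q (V k) (V k)) l (𝓝 ((1 / 2 : ℝ) • Q v v)) := by
    have : Continuous fun v => (1 / 2 : ℝ) • Q v v := by fun_prop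
    exact (this.tendsto v).comp hV
  have h6 := h4.add h5
  rw [zero_add] at h6
  refine h6.congr' ?_
  filter_upwards [hpos] with k hk
  have : (t k ^ 2) ≠ 0 := by positivity
  simp only [Function.comp_apply, map_smul, smul_apply]
  rw [smul_smul (t k) (t k), ← sq, smul_comm (1 / 2 : ℝ) (t k ^ 2), smul_sub _ _ (t k ^ 2 • _),
    smul_smul (t k ^ 2)⁻¹ (t k ^ 2), inv_mul_cancel₀ this, one_smul]
  abel

end Taylor

/-! ### Normal cones of convex sets. -/

section ConvexNormal

variable {E : Type*} [NormedAddCommGroup E] [InnerProductSpace ℝ E]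

theorem sub_mem_tangentCone {C : Set E} (hC : Convex ℝ C) {z c : E} (hz : z ∈ C) (hc : c ∈ C) :
    c - z ∈ tangentCone C z := by
  refine ⟨fun k => 1 / ((k : ℝ) + 1), fun _ => c - z, fun k => by positivity,
    tendsto_one_div_add_atTop_nhds_zero_nat, tendsto_const_nhds, fun k => ?_⟩
  exact hC.add_smul_sub_mem hz hc ⟨by positivity, by
    rw [div_le_one (by positivity)]; linarith [(Nat.cast_nonneg k : (0 : ℝ) ≤ k)]⟩

theorem mem_regularNormalCone_iff_of_convex {C : Set E} (hC : Convex ℝ C) {z v : E} :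
    v ∈ regularNormalCone C z ↔ z ∈ C ∧ ∀ c ∈ C, inner ℝ v (c - z) ≤ 0 := by
  refine and_congr_right fun hz => ⟨fun h c hc => h _ (sub_mem_tangentCone hC hz hc), ?_⟩
  rintro h u ⟨t, u', ht, -, hu', hmem⟩
  refine le_of_tendsto (tendsto_const_nhds.inner hu') (Eventually.of_forall fun k => ?_)
  have h1 := h _ (hmem k)
  rw [add_sub_cancel_left, inner_smul_right] at h1
  exact nonpos_of_mul_nonpos_right h1 (ht k)

theorem mem_limitingNormalCone_iff_of_convex {C : Set E} (hC : Convex ℝ C) {z v : E} :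
    v ∈ limitingNormalCone C z ↔ z ∈ C ∧ ∀ c ∈ C, inner ℝ v (c - z) ≤ 0 := by
  constructor
  · rintro ⟨hz, z', v', -, hz', hv', h⟩
    refine ⟨hz, fun c hc => ?_⟩
    refine le_of_tendsto (hv'.inner (tendsto_const_nhds.sub hz')) (Eventually.of_forall fun k => ?_)
    exact ((mem_regularNormalCone_iff_of_convex hC).1 (h k)).2 c hc
  · rintro ⟨hz, h⟩
    exact ⟨hz, fun _ => z, fun _ => v, fun _ => hz, tendsto_const_nhds, tendsto_const_nhds,
      fun _ => (mem_regularNormalCone_iff_of_convex hC).2 ⟨hz, h⟩⟩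

end ConvexNormal

/-! ### Hessians as second Fréchet derivatives. -/

section SecondOrder

variable {n m r : ℕ}

theorem inner_gradient_eq {E : Type*} [NormedAddCommGroup E] [InnerProductSpace ℝ E]
    [CompleteSpace E] (φ : E → ℝ) (y u : E) : inner ℝ u (gradient φ y) = fderiv ℝ φ y u := by
  rw [real_inner_comm, gradient, InnerProductSpace.toDual_symm_apply]

theorem differentiable_gradient {φ : Euc m → ℝ} (hφ : ContDiff ℝ 2 φ) :
    Differentiable ℝ (gradient φ) := by
  intro y
  have hd : DifferentiableAt ℝ (fderiv ℝ φ) y :=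
    (hφ.fderiv_right (m := 1) (by norm_num)).differentiable (by norm_num) y
  rw [differentiableAt_euclidean]
  intro i
  have e : (fun y' => gradient φ y' i) = fun y' => fderiv ℝ φ y' (EuclideanSpace.single i 1) := by
    funext y'
    rw [← inner_gradient_eq, EuclideanSpace.inner_single_left]
    simp
  rw [e]
  exact hd.clm_apply (differentiableAt_const _)

/-- Both sides are the derivative of the scalar function `y' ↦ ⟪u, ∇φ(y')⟫ = Dφ(y') u`. -/
theorem inner_hessian {φ : Euc m → ℝ} (hφ : ContDiff ℝ 2 φ) (y u v : Euc m) :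
    inner ℝ u (hessian φ y v) = fderiv ℝ (fderiv ℝ φ) y v u := by
  have hd : HasFDerivAt (fderiv ℝ φ) (fderiv ℝ (fderiv ℝ φ) y) y :=
    ((hφ.fderiv_right (m := 1) (by norm_num)).differentiable (by norm_num) y).hasFDerivAt
  have h1 : HasFDerivAt (fun y' => inner ℝ u (gradient φ y'))
      ((innerSL ℝ u).comp (hessian φ y)) y :=
    (innerSL ℝ u).hasFDerivAt.comp y (differentiable_gradient hφ y).hasFDerivAt
  have h2 : HasFDerivAt (fun y' => inner ℝ u (gradient φ y'))
      ((fderiv ℝ (fderiv ℝ φ) y).flip u) y := by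
    simp only [inner_gradient_eq]
    simpa using hd.clm_apply (hasFDerivAt_const u y)
  exact DFunLike.congr_fun (h1.unique h2) v

theorem inner_hessian_comm {φ : Euc m → ℝ} (hφ : ContDiff ℝ 2 φ) (y u v : Euc m) :
    inner ℝ u (hessian φ y v) = inner ℝ v (hessian φ y u) := by
  rw [inner_hessian hφ, inner_hessian hφ]
  exact (hφ.contDiffAt.isSymmSndFDerivAt (by simp)) v u

theorem inner_hessG {g : Euc m → Euc r} (hg : ContDiff ℝ 2 g) (l : Euc r) (y u v : Euc m) :
    inner ℝ u (hessG g l y v) = inner ℝ l (fderiv ℝ (fderiv ℝ g) y v u) := by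
  have hφ : ContDiff ℝ 2 fun y' => inner ℝ l (g y') := contDiff_const.inner ℝ hg
  rw [hessG, inner_hessian hφ]
  have e : fderiv ℝ (fun y' => inner ℝ l (g y'))
      = fun y' => (innerSL ℝ l).comp (fderiv ℝ g y') := by
    funext y'
    exact ((innerSL ℝ l).hasFDerivAt.comp y'
      ((hg.differentiable (by norm_num)) y').hasFDerivAt).fderiv
  have hd : HasFDerivAt (fderiv ℝ g) (fderiv ℝ (fderiv ℝ g) y) y :=
    ((hg.fderiv_right (m := 1) (by norm_num)).differentiable (by norm_num) y).hasFDerivAt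
  rw [e]
  have h2 := ((hasFDerivAt_const (innerSL ℝ l) y).clm_comp hd).fderiv
  rw [h2]
  simp

theorem snd_fderiv_comm {g : Euc m → Euc r} (hg : ContDiff ℝ 2 g) (y u v : Euc m) :
    fderiv ℝ (fderiv ℝ g) y u v = fderiv ℝ (fderiv ℝ g) y v u :=
  (hg.contDiffAt.isSymmSndFDerivAt (by simp)) u v

theorem inner_gradient_component {g : Euc m → Euc r} (hg : ContDiff ℝ 2 g) (y v : Euc m)
    (i : Fin r) : inner ℝ (gradient (fun y' => g y' i) y) v = fderiv ℝ g y v i := by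
  rw [real_inner_comm, inner_gradient_eq]
  have := ((EuclideanSpace.proj (𝕜 := ℝ) i).hasFDerivAt.comp y
    ((hg.differentiable (by norm_num)) y).hasFDerivAt).fderiv
  exact DFunLike.congr_fun this v

end SecondOrder

/-! ### The multiplier set and the critical cone in coordinates. -/

section Multipliers

variable {n m r : ℕ} {f : Euc n → Euc m → ℝ} {g : Euc m → Euc r} {x : Euc n} {y : Euc m}

theorem inner_eq_sum (u v : Euc r) : inner ℝ u v = ∑ i, u i * v i := by
  simp [PiLp.inner_apply, mul_comm]

theorem mem_multipliers_iff (hy : y ∈ lowerFeasible g) {l : Euc r} :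
    l ∈ multipliers f g x y ↔
      (∀ v, inner ℝ l (fderiv ℝ g y v) = inner ℝ (-gradY f x y) v) ∧
      (∀ i, 0 ≤ l i) ∧ ∀ i, g y i ≠ 0 → l i = 0 := by
  refine and_congr ?_ (and_congr_right fun hl => ⟨?_, ?_⟩)
  · rw [eq_comm, add_eq_zero_iff_neg_eq]
    constructor
    · intro h v
      rw [h, ContinuousLinearMap.adjoint_inner_left]
    · intro h
      refine ext_inner_right ℝ fun v => ?_
      rw [ContinuousLinearMap.adjoint_inner_left, h]
  · rintro ⟨-, h⟩ i hi
    rw [inner_eq_sum, Finset.sum_eq_zero_iff_of_nonneg fun j _ =>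
      mul_nonneg (by simpa using hy j) (hl j)] at h
    have := h i (Finset.mem_univ i)
    simpa [hi] using this
  · intro h
    refine ⟨fun i => neg_nonneg.2 (hy i), ?_⟩
    rw [inner_eq_sum]
    refine Finset.sum_eq_zero fun i _ => ?_
    by_cases hi : g y i = 0
    · simp [hi]
    · simp [h i hi]

theorem mem_tangentCone_nonpos_iff {c u : Euc r} (hc : ∀ i, c i ≤ 0) :
    u ∈ tangentCone {u : Euc r | ∀ i, u i ≤ 0} c ↔ ∀ i, c i = 0 → u i ≤ 0 := by
  constructor
  · rintro ⟨t, u', ht, -, hu', hmem⟩ i hi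
    have : Tendsto (fun k => u' k i) atTop (𝓝 (u i)) :=
      ((EuclideanSpace.proj (𝕜 := ℝ) i).continuous.tendsto u).comp hu'
    refine le_of_tendsto this (Eventually.of_forall fun k => ?_)
    have h1 := hmem k i
    simp only [PiLp.add_apply, PiLp.smul_apply, smul_eq_mul, hi, zero_add] at h1
    exact nonpos_of_mul_nonpos_right h1 (ht k)
  · intro h
    have h1 : ∀ᶠ t : ℝ in 𝓝[>] 0, ∀ i, c i + t * u i ≤ 0 := by
      refine eventually_all.2 fun i => ?_
      rcases (hc i).eq_or_lt with h0 | h0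
      · filter_upwards [self_mem_nhdsWithin] with t ht
        rw [h0, zero_add]
        exact mul_nonpos_of_nonneg_of_nonpos (le_of_lt ht) (h i h0)
      · have : Tendsto (fun ε : ℝ => c i + ε * u i) (𝓝[>] 0) (𝓝 (c i + 0 * u i)) :=
          tendsto_nhdsWithin_of_tendsto_nhds (Continuous.tendsto (by fun_prop) 0)
        rw [zero_mul, add_zero] at this
        exact (this.eventually (gt_mem_nhds h0)).mono fun _ h => h.le
    have hseq : Tendsto (fun k : ℕ => 1 / ((k : ℝ) + 1)) atTop (𝓝[>] 0) :=
      tendsto_nhdsWithin_iff.2 ⟨tendsto_one_div_add_atTop_nhds_zero_nat,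
        Eventually.of_forall fun k => by simp only [mem_Ioi]; positivity⟩
    obtain ⟨N, hN⟩ := eventually_atTop.1 (hseq.eventually h1)
    refine ⟨fun k => 1 / (((k + N : ℕ) : ℝ) + 1), fun _ => u, fun k => by positivity,
      tendsto_one_div_add_atTop_nhds_zero_nat.comp (tendsto_add_atTop_nat N),
      tendsto_const_nhds, fun k i => ?_⟩
    simpa using hN (k + N) (by omega) i

theorem mem_criticalCone_iff (hy : y ∈ lowerFeasible g) {v : Euc m} :
    v ∈ criticalCone f g x y ↔
      (∀ i, g y i = 0 → fderiv ℝ g y v i ≤ 0) ∧ inner ℝ (-gradY f x y) v = 0 := by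
  rw [criticalCone, mem_ofPred_eq, mem_tangentCone_nonpos_iff hy, inner_neg_left, neg_eq_zero]

/-- The linear map whose fibre, intersected with the nonnegative orthant, is the multiplier set. -/
def multiplierMap (g : Euc m → Euc r) (y : Euc m) : Euc r →ₗ[ℝ] Euc m × ℝ :=
  (ContinuousLinearMap.adjoint (fderiv ℝ g y)).toLinearMap.prod (innerSL ℝ (-(g y))).toLinearMap

/-- For fixed `y`, complementarity is one linear equation in the multiplier, so the results on
standard form polyhedra apply. -/
theorem multipliers_eq_stdPolyhedron (hy : y ∈ lowerFeasible g) :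
    multipliers f g x y = stdPolyhedron (multiplierMap g y) (-gradY f x y, 0) := by
  ext l
  have hy' : ∀ i, 0 ≤ -(g y i) := fun i => neg_nonneg.2 (hy i)
  simp only [multipliers, stdPolyhedron, multiplierMap, mem_ofPred_eq, LinearMap.prod_apply,
    Function.prod, ContinuousLinearMap.coe_coe, innerSL_apply_apply, Prod.mk.injEq]
  rw [eq_comm (a := (0 : Euc m)), add_eq_zero_iff_neg_eq, eq_comm]
  tauto

theorem finite_extremeMultipliers (hy : y ∈ lowerFeasible g) :
    (extremeMultipliers f g x y).Finite := by
  rw [extremeMultipliers, multipliers_eq_stdPolyhedron hy]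
  exact finite_extremePoints_stdPolyhedron

end Multipliers

/-! ### Convexity of the lower level constraints. -/

section LowerLevel

variable {n m r : ℕ} {f : Euc n → Euc m → ℝ} {g : Euc m → Euc r} {x : Euc n} {y : Euc m}

theorem AffineOrSlater.convexOn (h : AffineOrSlater g) (i : Fin r) :
    ConvexOn ℝ univ fun y => g y i := by
  rcases h with ⟨A, hA⟩ | ⟨h, -⟩
  · refine ⟨convex_univ, fun u _ v _ a b _ _ hab => le_of_eq ?_⟩
    simp only [hA]
    rw [Convex.combo_affine_apply hab]
    simp
  · exact h i

theorem isClosed_lowerFeasible (hg : Continuous g) : IsClosed (lowerFeasible g) := by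
  have : lowerFeasible g = ⋂ i, {y | g y i ≤ 0} := by ext; simp [lowerFeasible]
  rw [this]
  exact isClosed_iInter fun i => isClosed_le (by fun_prop) continuous_const

theorem AffineOrSlater.convex_lowerFeasible (h : AffineOrSlater g) :
    Convex ℝ (lowerFeasible g) := by
  have : lowerFeasible g = ⋂ i, {y | y ∈ univ ∧ g y i ≤ 0} := by ext; simp [lowerFeasible]
  rw [this]
  exact convex_iInter fun i => (h.convexOn i).convex_le 0

theorem AffineOrSlater.fderiv_le (h : AffineOrSlater g) (hg : ContDiff ℝ 2 g) (z : Euc m)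
    (i : Fin r) : g y i + fderiv ℝ g y (z - y) i ≤ g z i := by
  have hd : HasFDerivAt (fun y => g y i) ((EuclideanSpace.proj (𝕜 := ℝ) i).comp (fderiv ℝ g y)) y :=
    (EuclideanSpace.proj (𝕜 := ℝ) i).hasFDerivAt.comp y
      ((hg.differentiable (by norm_num)) y).hasFDerivAt
  have hline : HasDerivAt (fun t : ℝ => g (AffineMap.lineMap y z t) i)
      (fderiv ℝ g y (z - y) i) 0 := by
    have h1 : HasDerivAt (fun t : ℝ => AffineMap.lineMap y z t) (z - y) (0 : ℝ) :=
      AffineMap.hasDerivAt_lineMap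
    have h2 : HasFDerivAt (fun y => g y i)
        ((EuclideanSpace.proj (𝕜 := ℝ) i).comp (fderiv ℝ g y)) (AffineMap.lineMap y z (0 : ℝ)) := by
      simpa using hd
    exact h2.comp_hasDerivAt (0 : ℝ) h1
  have hc : ConvexOn ℝ univ (fun t : ℝ => g (AffineMap.lineMap y z t) i) := by
    have := (h.convexOn i).comp_affineMap (AffineMap.lineMap y z : ℝ →ᵃ[ℝ] Euc m)
    rw [preimage_univ] at this
    exact this
  have := hc.le_slope_of_hasDerivAt (mem_univ 0) (mem_univ 1) one_pos hline
  simp [slope_def_field] at this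
  simp only [map_sub, PiLp.sub_apply]
  linarith

end LowerLevel

/-! ### Feasible arcs, existence of multipliers and linear programming duality. -/

section Arcs

variable {n m r : ℕ} {f : Euc n → Euc m → ℝ} {g : Euc m → Euc r} {x : Euc n} {y : Euc m}

theorem fderiv_fderiv_affine {A : Euc m →ᵃ[ℝ] Euc r} (hA : ∀ y, g y = A y) (y u v : Euc m) :
    fderiv ℝ (fderiv ℝ g) y u v = 0 := by
  have hg : g = fun z => A.linear.toContinuousLinearMap z + A 0 := by
    funext z
    rw [hA]
    exact congrFun A.decomp z
  have h : fderiv ℝ g = fun _ => A.linear.toContinuousLinearMap := by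
    funext z
    rw [hg, fderiv_add_const]
    exact ContinuousLinearMap.fderiv _
  rw [h]
  simp

theorem eq_of_affine {A : Euc m →ᵃ[ℝ] Euc r} (hA : ∀ y, g y = A y) (y u : Euc m) :
    g (y + u) = g y + fderiv ℝ g y u := by
  have hg : g = fun z => A.linear.toContinuousLinearMap z + A 0 := by
    funext z
    rw [hA]
    exact congrFun A.decomp z
  have h : fderiv ℝ g y = A.linear.toContinuousLinearMap := by
    rw [hg, fderiv_add_const]
    exact ContinuousLinearMap.fderiv _
  rw [h, hg]
  simp only [map_add]
  abel

/-- Feasible second order arcs: up to an arbitrarily small perturbation of `z`, the parabola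
`y + t v + t²/2 z` stays in the feasible set if `v` and `z` satisfy the linearized conditions
of first and second order. -/
theorem AffineOrSlater.exists_arc (h : AffineOrSlater g) (hg : ContDiff ℝ 2 g)
    (hy : y ∈ lowerFeasible g) {v z : Euc m}
    (hv : ∀ i, g y i = 0 → fderiv ℝ g y v i ≤ 0)
    (hz : ∀ i, g y i = 0 → (fderiv ℝ g y z + fderiv ℝ (fderiv ℝ g) y v v) i ≤ 0)
    {ε : ℝ} (hε : 0 < ε) :
    ∃ z', ‖z' - z‖ ≤ ε ∧
      ∀ᶠ t : ℝ in 𝓝[>] 0, y + t • (v + (t / 2) • z') ∈ lowerFeasible g := by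
  have inactive : ∀ z' : Euc m, ∀ i, g y i < 0 →
      ∀ᶠ t : ℝ in 𝓝[>] 0, g (y + t • (v + (t / 2) • z')) i ≤ 0 := by
    intro z' i hi
    have hc : Continuous fun t : ℝ => g (y + t • (v + (t / 2) • z')) i := by
      have := hg.continuous
      fun_prop
    have ht : Tendsto (fun t : ℝ => g (y + t • (v + (t / 2) • z')) i) (𝓝[>] 0) (𝓝 (g y i)) := by
      have := hc.tendsto 0
      simp only [zero_smul, add_zero] at this
      exact this.mono_left nhdsWithin_le_nhds
    exact (ht.eventually (gt_mem_nhds hi)).mono fun _ h => h.le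
  rcases h with ⟨A, hA⟩ | ⟨hconv, y₀, hy₀⟩
  -- In the affine case the expansion is exact and the second derivative vanishes, so `z` needs no
  -- perturbation.
  · refine ⟨z, by simpa using hε.le, ?_⟩
    refine eventually_all.2 fun i => ?_
    rcases (hy i).eq_or_lt with h0 | h0
    · filter_upwards [self_mem_nhdsWithin] with t ht
      have ht : 0 < t := ht
      have h1 := hv i h0
      have h2 := hz i h0
      rw [fderiv_fderiv_affine hA, add_zero] at h2
      rw [eq_of_affine hA]
      simp only [map_add, map_smul, PiLp.add_apply, PiLp.smul_apply, smul_eq_mul, h0, zero_add]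
      have : t / 2 * fderiv ℝ g y z i ≤ 0 :=
        mul_nonpos_of_nonneg_of_nonpos (by positivity) h2
      exact mul_nonpos_of_nonneg_of_nonpos ht.le (by linarith)
    · exact inactive z i h0
  · set d := y₀ - y with hd
    have hd' : ∀ i, g y i = 0 → fderiv ℝ g y d i < 0 := by
      intro i hi
      have := AffineOrSlater.fderiv_le (Or.inr ⟨hconv, y₀, hy₀⟩) hg (y := y) y₀ i
      linarith [hy₀ i]
    -- By convexity the direction `d` to the Slater point strictly decreases every active
    -- constraint. A small multiple of it makes the second order inequalities strict within the
    -- tolerance `ε`.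
    set δ := ε / (‖d‖ + 1) with hδ
    have hδ0 : 0 < δ := by positivity
    refine ⟨z + δ • d, ?_, ?_⟩
    · rw [add_sub_cancel_left, norm_smul, Real.norm_of_nonneg hδ0.le, hδ, div_mul_eq_mul_div,
        div_le_iff₀ (by positivity)]
      nlinarith [norm_nonneg d]
    set z' := z + δ • d with hz'
    refine eventually_all.2 fun i => ?_
    rcases (hy i).eq_or_lt with h0 | h0
    · have hV : Tendsto (fun t : ℝ => v + (t / 2) • z') (𝓝[>] 0) (𝓝 v) := by
        have hc : Continuous fun t : ℝ => v + (t / 2) • z' := by fun_prop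
        have := hc.tendsto 0
        simp only [zero_div, zero_smul, add_zero] at this
        exact this.mono_left nhdsWithin_le_nhds
      have hlim := tendsto_second_order_quotient hg y (t := fun t : ℝ => t) tendsto_id hV
      -- Adding `Dg(y)z' / 2` restores the part of the linear term due to `z'`. The limit is half
      -- the left side of the second order inequality for `z'`.
      have hlim' := (hlim.add_const ((1 / 2 : ℝ) • fderiv ℝ g y z'))
      have hlim2 := ((EuclideanSpace.proj (𝕜 := ℝ) i).continuous.tendsto _).comp hlim'
      have hneg : EuclideanSpace.proj (𝕜 := ℝ) i ((1 / 2 : ℝ) • fderiv ℝ (fderiv ℝ g) y v v +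
          (1 / 2 : ℝ) • fderiv ℝ g y z') < 0 := by
        have h1 := hz i h0
        have h2 := mul_pos_of_neg_of_neg (hd' i h0) (neg_lt_zero.2 hδ0)
        simp only [hz', map_add, map_smul, PiLp.add_apply, smul_eq_mul,
          PiLp.proj_apply] at h1 ⊢
        linarith
      filter_upwards [hlim2.eventually (gt_mem_nhds hneg), self_mem_nhdsWithin] with t h1 ht
      have ht : 0 < t := ht
      have h2 := hv i h0
      simp only [Function.comp_apply, map_add, map_smul, PiLp.add_apply, PiLp.sub_apply,
        PiLp.smul_apply, smul_eq_mul, PiLp.proj_apply, h0, sub_zero] at h1 ⊢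
      have ht2 : 0 < t ^ 2 := by positivity
      have h3 := mul_neg_of_pos_of_neg ht2 h1
      rw [mul_add, mul_inv_cancel_left₀ ht2.ne'] at h3
      have h4 := mul_nonpos_of_nonneg_of_nonpos ht.le h2
      nlinarith
    · exact inactive z' i h0

/-- A vector `z` satisfying the second order linearized inequalities for `v` exists, so that the
linear program defining the directional multipliers is dual feasible. -/
theorem AffineOrSlater.exists_dual_feasible (h : AffineOrSlater g) (hg : ContDiff ℝ 2 g)
    (y v : Euc m) :
    ∃ z, ∀ i, g y i = 0 → (fderiv ℝ g y z + fderiv ℝ (fderiv ℝ g) y v v) i ≤ 0 := by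
  rcases h with ⟨A, hA⟩ | ⟨hconv, y₀, hy₀⟩
  · exact ⟨0, fun i _ => by simp [fderiv_fderiv_affine hA]⟩
  · have hd' : ∀ i, g y i = 0 → fderiv ℝ g y (y₀ - y) i < 0 := by
      intro i hi
      have := AffineOrSlater.fderiv_le (Or.inr ⟨hconv, y₀, hy₀⟩) hg (y := y) y₀ i
      linarith [hy₀ i]
    have : ∀ᶠ s : ℝ in atTop, ∀ i, g y i = 0 →
        (fderiv ℝ g y (s • (y₀ - y)) + fderiv ℝ (fderiv ℝ g) y v v) i ≤ 0 := by
      refine eventually_all.2 fun i => ?_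
      by_cases hi : g y i = 0
      · filter_upwards [eventually_ge_atTop
          (fderiv ℝ (fderiv ℝ g) y v v i / (-fderiv ℝ g y (y₀ - y) i))] with s hs _
        rw [div_le_iff₀ (by linarith [hd' i hi])] at hs
        simp only [map_smul, PiLp.add_apply, PiLp.smul_apply, smul_eq_mul]
        linarith
      · exact Eventually.of_forall fun _ h => absurd h hi
    obtain ⟨s, hs⟩ := this.exists
    exact ⟨s • (y₀ - y), hs⟩

/-- Normals to the feasible set are polar to the linearized cone. -/
theorem AffineOrSlater.inner_le_zero_of_linearized (h : AffineOrSlater g) (hg : ContDiff ℝ 2 g)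
    {ν : Euc m} (hν : ν ∈ limitingNormalCone (lowerFeasible g) y) {d : Euc m}
    (hd : ∀ i, g y i = 0 → fderiv ℝ g y d i ≤ 0) : inner ℝ ν d ≤ 0 := by
  obtain ⟨hy, hν⟩ := (mem_limitingNormalCone_iff_of_convex h.convex_lowerFeasible).1 hν
  refine le_of_forall_pos_le_add fun ε hε => ?_
  -- With zero velocity the arc is `y + (t²/2) z'`, so `exists_arc` also covers first order
  -- directions.
  obtain ⟨z', hz', hev⟩ := h.exists_arc hg hy (v := 0) (z := d) (fun i _ => by simp)
    (fun i hi => by simpa using hd i hi) (ε := ε / (‖ν‖ + 1)) (by positivity)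
  obtain ⟨t, ht, ht0⟩ := (hev.and self_mem_nhdsWithin).exists
  have ht0 : 0 < t := ht0
  have h1 := hν _ ht
  rw [add_sub_cancel_left, zero_add, inner_smul_right, inner_smul_right, ← mul_assoc] at h1
  have h2 : inner ℝ ν z' ≤ 0 := nonpos_of_mul_nonpos_right h1 (by positivity)
  have h3 : inner ℝ ν (d - z') ≤ ε := by
    refine (real_inner_le_norm _ _).trans ?_
    rw [norm_sub_rev]
    calc ‖ν‖ * ‖z' - d‖ ≤ (‖ν‖ + 1) * (ε / (‖ν‖ + 1)) := by gcongr; linarith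
      _ = ε := by field_simp
  rw [inner_sub_right] at h3
  linarith

/-- The functional of the normal `-∇_y f` is nonpositive on the linearized cone, so the Farkas lemma
writes it as a nonnegative combination of active gradients. -/
theorem AffineOrSlater.multipliers_nonempty (h : AffineOrSlater g) (hg : ContDiff ℝ 2 g)
    (hν : -gradY f x y ∈ limitingNormalCone (lowerFeasible g) y) :
    (multipliers f g x y).Nonempty := by
  classical
  obtain ⟨c, hc, hb⟩ := farkas (V := Euc m) (Finset.univ.filter fun i => g y i = 0)
    (fun i => ((EuclideanSpace.proj (𝕜 := ℝ) i).comp (fderiv ℝ g y)).toLinearMap)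
    (innerSL ℝ (-gradY f x y)).toLinearMap (fun d hd =>
      h.inner_le_zero_of_linearized hg hν fun i hi => hd i (by simpa using hi))
  refine ⟨WithLp.toLp 2 fun i => if g y i = 0 then c i else 0,
    (mem_multipliers_iff hν.1).2 ⟨fun v => ?_, fun i => ?_, fun i hi => by simp [hi]⟩⟩
  · have := LinearMap.congr_fun hb v
    simp only [ContinuousLinearMap.coe_coe, innerSL_apply_apply, LinearMap.sum_apply,
      Finset.sum_filter] at this
    rw [this, inner_eq_sum]
    refine Finset.sum_congr rfl fun i _ => ?_
    by_cases hi : g y i = 0 <;> simp [hi]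
  · by_cases hi : g y i = 0 <;> simp [hi, hc]

theorem inner_le_of_mem_multipliers (hy : y ∈ lowerFeasible g) {l : Euc r}
    (hl : l ∈ multipliers f g x y) {u : Euc r} (hu : ∀ i, g y i = 0 → u i ≤ 0) :
    inner ℝ l u ≤ 0 := by
  obtain ⟨-, h1, h2⟩ := (mem_multipliers_iff hy).1 hl
  rw [inner_eq_sum]
  refine Finset.sum_nonpos fun i _ => ?_
  by_cases hi : g y i = 0
  · exact mul_nonpos_of_nonneg_of_nonpos (h1 i) (hu i hi)
  · simp [h2 i hi]

theorem mem_dirMultipliers_iff (hg : ContDiff ℝ 2 g) {v : Euc m} {l : Euc r} :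
    l ∈ dirMultipliers f g x y v ↔ l ∈ multipliers f g x y ∧ ∀ l' ∈ multipliers f g x y,
      inner ℝ l' (fderiv ℝ (fderiv ℝ g) y v v) ≤ inner ℝ l (fderiv ℝ (fderiv ℝ g) y v v) := by
  simp only [dirMultipliers, mem_ofPred_eq, isMaxOn_iff, inner_hessG hg]

/-- For every direction there is an extreme point of the multiplier set among the directional
multipliers. -/
theorem AffineOrSlater.dirMultipliers_inter_extreme_nonempty (h : AffineOrSlater g)
    (hg : ContDiff ℝ 2 g) (hν : -gradY f x y ∈ limitingNormalCone (lowerFeasible g) y)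
    (v : Euc m) : (dirMultipliers f g x y v ∩ extremeMultipliers f g x y).Nonempty := by
  have hy := hν.1
  obtain ⟨z, hz⟩ := h.exists_dual_feasible hg y v
  set q := fderiv ℝ (fderiv ℝ g) y v v with hq
  have hM : ∀ l ∈ multipliers f g x y, inner ℝ l q ≤ -inner ℝ (-gradY f x y) z := by
    intro l hl
    have h1 := inner_le_of_mem_multipliers hy hl hz
    rw [inner_add_right, ((mem_multipliers_iff hy).1 hl).1] at h1
    linarith
  have hdom : ∀ l ∈ multipliers f g x y, ∃ l' ∈ extremeMultipliers f g x y,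
      inner ℝ l q ≤ inner ℝ l' q := by
    have := exists_extremePoint_ge (T := multiplierMap g y) (b := (-gradY f x y, 0))
      (innerSL ℝ q).toLinearMap (M := -inner ℝ (-gradY f x y) z)
    rw [← multipliers_eq_stdPolyhedron hy] at this
    simp only [ContinuousLinearMap.coe_coe, innerSL_apply_apply, real_inner_comm _ q] at this
    exact this hM
  obtain ⟨l₀, hl₀⟩ := h.multipliers_nonempty hg hν
  obtain ⟨l₁, hl₁, -⟩ := hdom l₀ hl₀
  obtain ⟨l, hl, hmax⟩ := Set.exists_max_image (extremeMultipliers f g x y)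
    (fun l => inner ℝ l q) (finite_extremeMultipliers hy) ⟨l₁, hl₁⟩
  refine ⟨l, (mem_dirMultipliers_iff hg).2 ⟨hl.1, fun l' hl' => ?_⟩, hl⟩
  obtain ⟨l'', hl'', hle⟩ := hdom l' hl'
  exact hle.trans (hmax l'' hl'')

/-- Linear programming duality for the directional multipliers. -/
theorem exists_dual_solution (hg : ContDiff ℝ 2 g) (hy : y ∈ lowerFeasible g) {v : Euc m}
    {l : Euc r} (hl : l ∈ dirMultipliers f g x y v) :
    ∃ z, (∀ i, g y i = 0 → (fderiv ℝ g y z + fderiv ℝ (fderiv ℝ g) y v v) i ≤ 0) ∧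
      -inner ℝ (-gradY f x y) z ≤ inner ℝ l (fderiv ℝ (fderiv ℝ g) y v v) := by
  classical
  obtain ⟨hlm, hmax⟩ := (mem_dirMultipliers_iff hg).1 hl
  obtain ⟨hl1, hl2, hl3⟩ := (mem_multipliers_iff hy).1 hlm
  set q := fderiv ℝ (fderiv ℝ g) y v v with hq
  set xs := -gradY f x y with hxs
  set M := inner ℝ l q with hM
  by_contra hcon
  push Not at hcon
  -- If no dual point reaches the value `M`, the dual system homogenized by `s` forces `s ≤ 0`.
  -- Index `none` carries the objective inequality and `some i` the `i`-th constraint.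
  let a : Option (Fin r) → (Euc m × ℝ) →ₗ[ℝ] ℝ
    | none => -(innerSL ℝ xs).toLinearMap.coprod (M • LinearMap.id)
    | some i => (((EuclideanSpace.proj (𝕜 := ℝ) i).comp (fderiv ℝ g y)).toLinearMap).coprod
        (q i • LinearMap.id)
  obtain ⟨c, hc, hb⟩ := farkas (Finset.univ.filter fun o : Option (Fin r) =>
      ∀ i, o = some i → g y i = 0) a (LinearMap.snd ℝ (Euc m) ℝ) (by
    rintro ⟨z, s⟩ hzs
    by_contra hs
    have hs : 0 < s := not_le.1 hs
    have h1 : ∀ i, g y i = 0 → fderiv ℝ g y z i + q i * s ≤ 0 := by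
      intro i hi
      have := hzs (some i) (by simpa using hi)
      simpa [a] using this
    have h2 : -(inner ℝ xs z + M * s) ≤ 0 := by
      have := hzs none (by simp)
      simpa [a] using this
    have h3 := hcon (s⁻¹ • z) (fun i hi => by
      have := mul_nonpos_of_nonneg_of_nonpos (inv_pos.2 hs).le (h1 i hi)
      rw [mul_add, mul_comm (q i), inv_mul_cancel_left₀ hs.ne'] at this
      simpa using this)
    rw [inner_smul_right] at h3
    have h4 := mul_lt_mul_of_pos_left h3 hs
    rw [mul_neg, mul_inv_cancel_left₀ hs.ne'] at h4
    linarith)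
  set μ : Euc r := WithLp.toLp 2 fun i => if g y i = 0 then c (some i) else 0 with hμ
  have hμ0 : ∀ i, 0 ≤ μ i := by
    intro i
    by_cases hi : g y i = 0 <;> simp [hμ, hi, hc]
  have hμ1 : ∀ i, g y i ≠ 0 → μ i = 0 := fun i hi => by simp [hμ, hi]
  have key : ∀ z s, s = -(c none * (inner ℝ xs z + M * s))
      + (inner ℝ μ (fderiv ℝ g y z) + inner ℝ μ q * s) := by
    intro z s
    have := LinearMap.congr_fun hb (z, s)
    rw [LinearMap.sum_apply, Finset.sum_filter, Fintype.sum_option] at this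
    simp only [LinearMap.snd_apply, reduceCtorEq, false_implies, implies_true, if_true,
      Option.some.injEq, forall_eq'] at this
    refine this.trans ?_
    rw [inner_eq_sum μ, inner_eq_sum μ, Finset.sum_mul, ← Finset.sum_add_distrib]
    congr 1
    · simp [a]
    · refine Finset.sum_congr rfl fun i _ => ?_
      by_cases hi : g y i = 0
      · simp [hμ, hi, a]
        ring
      · simp [hμ, hi]
  have key1 : ∀ z, inner ℝ μ (fderiv ℝ g y z) = c none * inner ℝ xs z := by
    intro z
    have := key z 0
    linarith
  have key2 : inner ℝ μ q = 1 + c none * M := by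
    have := key 0 1
    simp only [inner_zero_right, map_zero] at this
    linarith
  have hc0 := hc none
  -- The Farkas coefficients make `(l + μ) / (1 + c none)` a multiplier of value `M + 1 / (1 + c
  -- none)`, against maximality of `l`. Adding `l` avoids a separate case `c none = 0`.
  have h5 := hmax ((1 / (1 + c none)) • (l + μ)) ((mem_multipliers_iff hy).2
    ⟨fun z => by
      rw [inner_smul_left, inner_add_left, hl1, key1]
      simp only [one_div, conj_trivial]
      rw [← hxs]
      field_simp,
    fun i => by
      have := add_nonneg (hl2 i) (hμ0 i)
      simp only [PiLp.smul_apply, PiLp.add_apply, smul_eq_mul]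
      positivity,
    fun i hi => by simp [hl3 i hi, hμ1 i hi]⟩)
  rw [inner_smul_left, inner_add_left, key2] at h5
  simp only [one_div, conj_trivial] at h5
  rw [inv_mul_le_iff₀ (by positivity)] at h5
  linarith

end Arcs

/-! ### Tangents to the graph of the normal cone mapping, by projection. -/

section Tangents

variable {n m r : ℕ} {f : Euc n → Euc m → ℝ} {g : Euc m → Euc r} {x : Euc n} {y : Euc m}

theorem exists_proj {C : Set (Euc m)} (hC : Convex ℝ C) (hcl : IsClosed C) (hne : C.Nonempty)
    (q : Euc m) : ∃ p ∈ C, ∀ c ∈ C, inner ℝ (q - p) (c - p) ≤ 0 := by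
  obtain ⟨p, hp, h⟩ := exists_norm_eq_iInf_of_complete_convex hne hcl.isComplete hC q
  exact ⟨p, hp, (norm_eq_iInf_iff_real_inner_le_zero hC hp).1 h⟩

/-- By the gradient inequality for convex components, the second order quotients paired with `l ≥ 0`
are nonnegative. This makes the energy below convex. -/
theorem inner_snd_fderiv_nonneg (h : AffineOrSlater g) (hg : ContDiff ℝ 2 g) {l : Euc r}
    (hl : ∀ i, 0 ≤ l i) (y v : Euc m) :
    0 ≤ inner ℝ l (fderiv ℝ (fderiv ℝ g) y v v) := by
  have hlim := (tendsto_const_nhds (x := l)).inner (𝕜 := ℝ) (tendsto_second_order_quotient hg y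
    (t := fun t : ℝ => t) (l := 𝓝[>] 0) (V := fun _ => v) tendsto_id tendsto_const_nhds)
  have h0 : 0 ≤ inner ℝ l ((1 / 2 : ℝ) • fderiv ℝ (fderiv ℝ g) y v v) := by
    refine ge_of_tendsto hlim ?_
    filter_upwards [self_mem_nhdsWithin] with t ht
    rw [inner_eq_sum]
    refine Finset.sum_nonneg fun i _ => mul_nonneg (hl i) ?_
    have h1 := h.fderiv_le hg (y := y) (y + t • v) i
    rw [add_sub_cancel_left] at h1
    simp only [map_smul, PiLp.smul_apply, PiLp.sub_apply, smul_eq_mul] at h1 ⊢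
    exact mul_nonneg (by positivity) (by linarith)
  rw [inner_smul_right] at h0
  linarith

/-- The energy estimate behind the directional differentiability of the projection. -/
theorem eq_of_energy_le {B : Euc m →L[ℝ] Euc m →L[ℝ] ℝ} (hsym : ∀ u v, B u v = B v u)
    (hpos : ∀ v, 0 ≤ B v v) {v v' u h : Euc m}
    (hh : ∀ w, inner ℝ h w = inner ℝ v w + B v w + inner ℝ u w)
    (huv : inner ℝ u v = 0) (huv' : inner ℝ u v' ≤ 0)
    (hle : B v' v' + ‖h - v'‖ ^ 2 ≤ B v v + ‖h - v‖ ^ 2) : v' = v := by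
  have e1 := norm_sub_sq_real h v'
  have e2 := norm_sub_sq_real h v
  have e3 := norm_sub_sq_real v v'
  have e4 := hpos (v' - v)
  simp only [map_sub, sub_apply] at e4
  have e5 := hh v
  have e6 := hh v'
  have e7 := hsym v v'
  have e8 : inner ℝ v v = ‖v‖ ^ 2 := real_inner_self_eq_norm_sq v
  have : ‖v - v'‖ ^ 2 ≤ 0 := by nlinarith
  have : ‖v - v'‖ = 0 := by nlinarith [norm_nonneg (v - v')]
  exact (sub_eq_zero.1 (norm_eq_zero.1 this)).symm

/-- Tangents to the graph of the normal cone mapping of the lower level feasible set. -/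
theorem AffineOrSlater.mem_tangentCone_gph (h : AffineOrSlater g) (hg : ContDiff ℝ 2 g)
    (hν : -gradY f x y ∈ limitingNormalCone (lowerFeasible g) y) {v u : Euc m} {l : Euc r}
    (hv : v ∈ criticalCone f g x y) (hl : l ∈ dirMultipliers f g x y v)
    (hu : u ∈ polar (criticalCone f g x y)) (huv : inner ℝ u v = 0) :
    WithLp.toLp 2 (v, hessG g l y v + u) ∈
      tangentCone (gph (limitingNormalCone (lowerFeasible g)))
        (WithLp.toLp 2 (y, -gradY f x y)) := by
  have hconv := h.convex_lowerFeasible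
  obtain ⟨hy, hνc⟩ := (mem_limitingNormalCone_iff_of_convex hconv).1 hν
  obtain ⟨hv1, hv2⟩ := (mem_criticalCone_iff hy).1 hv
  obtain ⟨hlm, hmax⟩ := (mem_dirMultipliers_iff hg).1 hl
  obtain ⟨hl1, hl2, hl3⟩ := (mem_multipliers_iff hy).1 hlm
  obtain ⟨z, hz, hzle⟩ := exists_dual_solution hg hy hl
  set xs := -gradY f x y with hxs
  set Q := fderiv ℝ (fderiv ℝ g) y with hQ
  set d := v + (hessG g l y v + u) with hd
  set t : ℕ → ℝ := fun k => 1 / ((k : ℝ) + 1) with ht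
  have htpos : ∀ k, 0 < t k := fun k => by simp only [ht]; positivity
  have ht0 : Tendsto t atTop (𝓝 0) := tendsto_one_div_add_atTop_nhds_zero_nat
  have ht0' : Tendsto t atTop (𝓝[>] 0) :=
    tendsto_nhdsWithin_iff.2 ⟨ht0, Eventually.of_forall htpos⟩
  -- The residual of the projection `p k` is a normal at `p k`. It equals `xs + t k • (d - V k)`, so
  -- each `k` supplies a point of the graph, and only `V k → v` along a subsequence remains.
  choose p hpΓ hp using fun k => exists_proj hconv (isClosed_lowerFeasible hg.continuous) ⟨y, hy⟩
    (y + xs + t k • d)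
  set V : ℕ → Euc m := fun k => (t k)⁻¹ • (p k - y) with hV
  have hpV : ∀ k, p k = y + t k • V k := fun k => by
    simp only [hV]
    rw [smul_inv_smul₀ (htpos k).ne', add_sub_cancel]
  have hVle : ∀ k, inner ℝ xs (V k) ≤ 0 := fun k => by
    have := hνc _ (hpΓ k)
    simp only [hV]
    rw [inner_smul_right]
    exact mul_nonpos_of_nonneg_of_nonpos (inv_nonneg.2 (htpos k).le) this
  -- comparison of the projection with an arbitrary feasible point
  have hcmp : ∀ k w, y + t k • w ∈ lowerFeasible g →
      -(2 * (inner ℝ xs (V k) / t k)) + ‖d - V k‖ ^ 2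
        ≤ -(2 * (inner ℝ xs w / t k)) + ‖d - w‖ ^ 2 := by
    intro k w hw
    have h1 := hp k _ hw
    have htk := htpos k
    rw [hpV k, show y + xs + t k • d - (y + t k • V k) = xs + t k • (d - V k) by
      rw [smul_sub]; abel, show y + t k • w - (y + t k • V k) = t k • (w - V k) by
      rw [smul_sub]; abel, inner_smul_right, inner_add_left, inner_smul_left, conj_trivial] at h1
    have h2 : inner ℝ xs (w - V k) + t k * inner ℝ (d - V k) (w - V k) ≤ 0 :=
      nonpos_of_mul_nonpos_right h1 htk
    have h3 : ‖d - w‖ ^ 2 = ‖d - V k‖ ^ 2 - 2 * inner ℝ (d - V k) (w - V k) + ‖w - V k‖ ^ 2 := by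
      rw [← norm_sub_sq_real]
      congr 2
      abel
    rw [inner_sub_right] at h2
    have h4 : inner ℝ xs w / t k - inner ℝ xs (V k) / t k + inner ℝ (d - V k) (w - V k) ≤ 0 := by
      have : inner ℝ xs w / t k - inner ℝ xs (V k) / t k + inner ℝ (d - V k) (w - V k)
          = (inner ℝ xs w - inner ℝ xs (V k) + t k * inner ℝ (d - V k) (w - V k)) / t k := by
        field_simp
      rw [this]
      exact div_nonpos_of_nonpos_of_nonneg h2 htk.le
    nlinarith [sq_nonneg ‖w - V k‖]
  have hcmp0 : ∀ k, -(2 * (inner ℝ xs (V k) / t k)) + ‖d - V k‖ ^ 2 ≤ ‖d‖ ^ 2 := fun k => by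
    simpa using hcmp k 0 (by simpa using hy)
  have hbd : ∀ k, V k ∈ Metric.closedBall d ‖d‖ := fun k => by
    rw [mem_closedBall_iff_norm, norm_sub_rev]
    have h1 := hcmp0 k
    have h2 : inner ℝ xs (V k) / t k ≤ 0 :=
      div_nonpos_of_nonpos_of_nonneg (hVle k) (htpos k).le
    exact abs_le_of_sq_le_sq' (by linarith) (norm_nonneg d) |>.2
  obtain ⟨v', -, φ, hφ, hVlim⟩ := tendsto_subseq_of_bounded Metric.isBounded_closedBall hbd
  have htφ : Tendsto (t ∘ φ) atTop (𝓝[>] 0) := ht0'.comp hφ.tendsto_atTop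
  have htφ0 : Tendsto (t ∘ φ) atTop (𝓝 0) := ht0.comp hφ.tendsto_atTop
  -- the limit direction is critical
  have hv' : v' ∈ criticalCone f g x y := by
    refine (mem_criticalCone_iff hy).2 ⟨fun i hi => ?_, ?_⟩
    · have hc : Continuous fun w : Euc m => fderiv ℝ g y w i := by fun_prop
      refine le_of_tendsto ((hc.tendsto v').comp hVlim) (Eventually.of_forall fun k => ?_)
      have h1 := h.fderiv_le hg (y := y) (p (φ k)) i
      have h2 := hpΓ (φ k) i
      rw [hpV, add_sub_cancel_left, ← hpV, hi, zero_add, map_smul, PiLp.smul_apply,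
        smul_eq_mul] at h1
      exact nonpos_of_mul_nonpos_right (h1.trans h2) (htpos _)
    · have hlim1 : Tendsto (fun k => inner ℝ xs (V (φ k))) atTop (𝓝 (inner ℝ xs v')) :=
        tendsto_const_nhds.inner hVlim
      refine le_antisymm (le_of_tendsto hlim1 (Eventually.of_forall fun k => hVle _)) ?_
      have hlim2 : Tendsto (fun k => -((t ∘ φ) k * (‖d‖ ^ 2 / 2))) atTop (𝓝 0) := by
        simpa using (htφ0.mul_const (‖d‖ ^ 2 / 2)).neg
      refine le_of_tendsto_of_tendsto hlim2 hlim1 (Eventually.of_forall fun k => ?_)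
      have h1 := hcmp0 (φ k)
      have h2 := htpos (φ k)
      have h3 : -(inner ℝ xs (V (φ k)) / t (φ k)) ≤ ‖d‖ ^ 2 / 2 := by
        nlinarith [sq_nonneg ‖d - V (φ k)‖]
      rw [← neg_div, div_le_iff₀ h2] at h3
      simp only [Function.comp_apply]
      linarith
  -- the limit direction has minimal energy
  have henergy : inner ℝ l (Q v' v') + ‖d - v'‖ ^ 2 ≤ inner ℝ l (Q v v) + ‖d - v‖ ^ 2 := by
    refine le_trans ?_ (add_le_add_left hzle _)
    refine le_of_forall_pos_le_add fun ε hε => ?_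
    -- Upper bound: the projection is compared with the arc of acceleration `z'` near the dual
    -- solution `z`. Since `⟪xs, v⟫ = 0`, the singular factor `1 / t` cancels.
    obtain ⟨z', hz', hev⟩ := h.exists_arc hg hy hv1 hz (ε := ε / (‖xs‖ + 1)) (by positivity)
    have hxz : -inner ℝ xs z' ≤ -inner ℝ xs z + ε := by
      have h3 : inner ℝ xs (z - z') ≤ ε := by
        refine (real_inner_le_norm _ _).trans ?_
        rw [norm_sub_rev]
        calc ‖xs‖ * ‖z' - z‖ ≤ (‖xs‖ + 1) * (ε / (‖xs‖ + 1)) := by gcongr; linarith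
          _ = ε := by field_simp
      rw [inner_sub_right] at h3
      linarith
    suffices H : inner ℝ l (Q v' v') + ‖d - v'‖ ^ 2 ≤ -inner ℝ xs z' + ‖d - v‖ ^ 2 by linarith
    -- Lower bound: `⟪l, g(p)⟫ ≤ 0 = ⟪l, g y⟫`, so the Taylor quotient paired with `l` bounds `-⟪xs,
    -- V⟫ / t` from below.
    have hL : Tendsto (fun k => 2 * inner ℝ l (((t ∘ φ) k ^ 2)⁻¹ •
          (g (y + (t ∘ φ) k • (V ∘ φ) k) - g y - (t ∘ φ) k • fderiv ℝ g y ((V ∘ φ) k)))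
          + ‖d - (V ∘ φ) k‖ ^ 2) atTop (𝓝 (2 * inner ℝ l ((1 / 2 : ℝ) • Q v' v') + ‖d - v'‖ ^ 2)) :=
      ((tendsto_const_nhds.inner (tendsto_second_order_quotient hg y htφ hVlim)).const_mul 2).add
        ((tendsto_const_nhds.sub hVlim).norm.pow 2)
    have hR : Tendsto (fun k => -inner ℝ xs z' + ‖d - (v + ((t ∘ φ) k / 2) • z')‖ ^ 2) atTop
        (𝓝 (-inner ℝ xs z' + ‖d - v‖ ^ 2)) := by
      have hc : Continuous fun s : ℝ => -inner ℝ xs z' + ‖d - (v + (s / 2) • z')‖ ^ 2 := by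
        fun_prop
      have := (hc.tendsto 0).comp htφ0
      simp only [zero_div, zero_smul, add_zero] at this
      exact this
    have hle := le_of_tendsto_of_tendsto hL hR (by
      filter_upwards [htφ.eventually hev] with k hk
      have hk' := hcmp (φ k) _ hk
      have htk := htpos (φ k)
      simp only [Function.comp_apply] at hk' ⊢
      refine le_trans ?_ (hk'.trans (le_of_eq ?_))
      · refine add_le_add_left ?_ _
        rw [inner_smul_right, inner_sub_right, inner_sub_right, inner_smul_right, hl1, ← hpV]
        have h1 : inner ℝ l (g (p (φ k))) ≤ 0 :=
          inner_le_of_mem_multipliers hy hlm fun i _ => hpΓ (φ k) i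
        have h2 : inner ℝ l (g y) = 0 := by
          rw [inner_eq_sum]
          refine Finset.sum_eq_zero fun i _ => ?_
          by_cases hi : g y i = 0
          · simp [hi]
          · simp [hl3 i hi]
        rw [h2, sub_zero, mul_sub]
        have h3 : (t (φ k) ^ 2)⁻¹ * inner ℝ l (g (p (φ k))) ≤ 0 :=
          mul_nonpos_of_nonneg_of_nonpos (by positivity) h1
        have h4 : (t (φ k) ^ 2)⁻¹ * (t (φ k) * inner ℝ xs (V (φ k)))
            = inner ℝ xs (V (φ k)) / t (φ k) := by
          field_simp
        linarith
      · rw [inner_add_right, hv2, inner_smul_right]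
        field_simp
        ring)
    rw [inner_smul_right] at hle
    linarith
  have hBsym : ∀ a b, inner ℝ l (Q a b) = inner ℝ l (Q b a) := fun a b => by
    rw [hQ, snd_fderiv_comm hg]
  -- Half the negative gradient of the energy at `v` is `u`; as `u` is polar to the critical cone
  -- and orthogonal to `v`, strong convexity leaves no other minimizer there.
  have hveq : v' = v := by
    refine eq_of_energy_le
      (B := (ContinuousLinearMap.compL ℝ (Euc m) (Euc r) ℝ (innerSL ℝ l)).comp Q) (u := u) (h := d)
      (fun a b => ?_) (fun a => ?_) (fun w => ?_) huv (hu v' hv') ?_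
    · simpa using hBsym a b
    · simpa using inner_snd_fderiv_nonneg h hg hl2 y a
    · have := inner_hessG hg l y w v
      rw [hd, inner_add_left, inner_add_left, real_inner_comm w (hessG g l y v), this]
      simp [hQ, add_assoc]
    · simpa using henergy
  rw [hveq] at hVlim
  refine ⟨t ∘ φ, fun k => WithLp.toLp 2 (V (φ k), d - V (φ k)), fun k => htpos _, htφ0, ?_,
    fun k => ?_⟩
  · have h1 : Tendsto (fun k => (V (φ k), d - V (φ k))) atTop (𝓝 (v, hessG g l y v + u)) := by
      refine hVlim.prodMk_nhds ?_
      have := (tendsto_const_nhds (x := d)).sub hVlim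
      simpa [hd] using this
    exact ((WithLp.prod_continuous_toLp 2 (Euc m) (Euc m)).tendsto _).comp h1
  · change xs + t (φ k) • (d - V (φ k)) ∈ limitingNormalCone _ (y + t (φ k) • V (φ k))
    rw [← hpV]
    refine (mem_limitingNormalCone_iff_of_convex hconv).2 ⟨hpΓ _, fun c hc => ?_⟩
    have := hp (φ k) c hc
    rwa [show y + xs + t (φ k) • d - p (φ k) = xs + t (φ k) • (d - V (φ k)) by
      rw [smul_sub, hpV (φ k)]; abel] at this

end Tangents

/-! ### Consequences for regular normals to the graph. -/

section Normals

variable {n m r : ℕ} {f : Euc n → Euc m → ℝ} {g : Euc m → Euc r} {x : Euc n} {y : Euc m}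

/-- The cone contains its bipolar because it is cut out by linear inequalities whose normals, the
active gradients and `±∇_y f`, lie in the polar. -/
theorem mem_criticalCone_of_forall_polar (hy : y ∈ lowerFeasible g) {ω : Euc m}
    (hω : ∀ u ∈ polar (criticalCone f g x y), inner ℝ ω u ≤ 0) : ω ∈ criticalCone f g x y := by
  refine (mem_criticalCone_iff hy).2 ⟨fun i hi => ?_, ?_⟩
  · have h1 : ∀ v, inner ℝ (ContinuousLinearMap.adjoint (fderiv ℝ g y)
        (EuclideanSpace.single i 1)) v = fderiv ℝ g y v i := fun v => by
      rw [ContinuousLinearMap.adjoint_inner_left, EuclideanSpace.inner_single_left]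
      simp
    have h2 := hω _ fun v hv => by
      rw [h1]
      exact ((mem_criticalCone_iff hy).1 hv).1 i hi
    rwa [real_inner_comm, h1] at h2
  · have h1 := hω (-gradY f x y) fun v hv => ((mem_criticalCone_iff hy).1 hv).2.le
    have h2 := hω (gradY f x y) fun v hv => by
      have := ((mem_criticalCone_iff hy).1 hv).2
      rw [inner_neg_left] at this
      linarith
    rw [real_inner_comm] at h1 h2
    rw [inner_neg_left] at h1 ⊢
    linarith

theorem add_mem_criticalCone (hy : y ∈ lowerFeasible g) {v u : Euc m}
    (hv : v ∈ criticalCone f g x y) (hu : u ∈ criticalCone f g x y) :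
    v + u ∈ criticalCone f g x y := by
  rw [mem_criticalCone_iff hy] at *
  refine ⟨fun i hi => ?_, by rw [inner_add_right, hv.2, hu.2, add_zero]⟩
  rw [map_add, PiLp.add_apply]
  exact add_nonpos (hv.1 i hi) (hu.1 i hi)

theorem smul_mem_criticalCone (hy : y ∈ lowerFeasible g) {u : Euc m}
    (hu : u ∈ criticalCone f g x y) {c : ℝ} (hc : 0 ≤ c) : c • u ∈ criticalCone f g x y := by
  rw [mem_criticalCone_iff hy] at *
  refine ⟨fun i hi => ?_, by rw [inner_smul_right, hu.2, mul_zero]⟩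
  rw [map_smul, PiLp.smul_apply]
  exact mul_nonpos_of_nonneg_of_nonpos hc (hu.1 i hi)

theorem zero_mem_criticalCone (hy : y ∈ lowerFeasible g) : 0 ∈ criticalCone f g x y :=
  (mem_criticalCone_iff hy).2 ⟨by simp, by simp⟩

/-- Orthogonality to `∇_y f` is automatic, since a multiplier writes `-∇_y f` as a combination of
active gradients. -/
theorem AffineOrSlater.mem_criticalCone_of_mem_activeNullspace (h : AffineOrSlater g)
    (hg : ContDiff ℝ 2 g) (hν : -gradY f x y ∈ limitingNormalCone (lowerFeasible g) y) {v : Euc m}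
    (hv : v ∈ activeNullspace g y) : v ∈ criticalCone f g x y := by
  have hv' : ∀ i, g y i = 0 → fderiv ℝ g y v i = 0 := fun i hi => by
    rw [← inner_gradient_component hg]
    exact hv i hi
  obtain ⟨l, hl⟩ := h.multipliers_nonempty hg hν
  obtain ⟨h1, -, h3⟩ := (mem_multipliers_iff hν.1).1 hl
  refine (mem_criticalCone_iff hν.1).2 ⟨fun i hi => (hv' i hi).le, ?_⟩
  rw [← h1, inner_eq_sum]
  refine Finset.sum_eq_zero fun i _ => ?_
  by_cases hi : g y i = 0
  · simp [hv' i hi]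
  · simp [h3 i hi]

theorem neg_mem_activeNullspace {v : Euc m} (hv : v ∈ activeNullspace g y) :
    -v ∈ activeNullspace g y := fun i hi => by rw [inner_neg_right, hv i hi, neg_zero]

theorem dirMultipliers_neg (hg : ContDiff ℝ 2 g) (v : Euc m) :
    dirMultipliers f g x y (-v) = dirMultipliers f g x y v := by
  ext l
  simp [mem_dirMultipliers_iff hg]

theorem isClosed_polar {E : Type*} [NormedAddCommGroup E] [InnerProductSpace ℝ E] (C : Set E) :
    IsClosed (polar C) := by
  have : polar C = ⋂ v ∈ C, {x | inner ℝ x v ≤ 0} := by ext; simp [polar]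
  rw [this]
  exact isClosed_biInter fun v _ => isClosed_le (by fun_prop) continuous_const

theorem convex_polar {E : Type*} [NormedAddCommGroup E] [InnerProductSpace ℝ E] (C : Set E) :
    Convex ℝ (polar C) := by
  intro a ha b hb s t hs ht _ v hv
  rw [inner_add_left, inner_smul_left, inner_smul_left]
  exact add_nonpos (mul_nonpos_of_nonneg_of_nonpos hs (ha v hv))
    (mul_nonpos_of_nonneg_of_nonpos ht (hb v hv))

/-- Separation of the convex hull of finitely many multipliers from the polar of the
critical cone. -/
theorem exists_mem_convexHull_add_mem_polar (hg : ContDiff ℝ 2 g) (hy : y ∈ lowerFeasible g)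
    {S : Set (Euc r)} (hS : S.Finite) (ξ ω : Euc m)
    (h : ∀ u ∈ criticalCone f g x y,
      ∃ l ∈ S, inner ℝ ξ u + inner ℝ l (fderiv ℝ (fderiv ℝ g) y ω u) ≤ 0) :
    ∃ l ∈ convexHull ℝ S, ξ + hessG g l y ω ∈ polar (criticalCone f g x y) := by
  by_contra hcon
  push Not at hcon
  set L := ContinuousLinearMap.adjoint (fderiv ℝ (fderiv ℝ g) y ω) with hL
  have hLl : ∀ l, L l = hessG g l y ω := fun l => by
    refine ext_inner_left ℝ fun u => ?_
    rw [inner_hessG hg, hL, ContinuousLinearMap.adjoint_inner_right, real_inner_comm]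
  set A : Set (Euc m) := (fun l => ξ + L l) '' convexHull ℝ S with hA
  have hAconv : Convex ℝ A := by
    have := ((convex_convexHull ℝ S).linear_image L.toLinearMap).translate ξ
    rwa [image_image] at this
  have hAcomp : IsCompact A := (hS.isCompact_convexHull ℝ).image (by fun_prop)
  have hdisj : Disjoint A (polar (criticalCone f g x y)) := by
    rw [Set.disjoint_left]
    rintro _ ⟨l, hl, rfl⟩
    change ξ + L l ∉ _
    rw [hLl]
    exact hcon l hl
  obtain ⟨F, a, b, hFa, hab, hFb⟩ := geometric_hahn_banach_compact_closed hAconv hAcomp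
    (convex_polar _) (isClosed_polar _) hdisj
  have hb0 : b < 0 := by
    have := hFb 0 fun v _ => by simp
    simpa using this
  -- A functional bounded below on a cone is nonnegative on it: otherwise a rescaled `k` takes
  -- exactly the value `b`. Hence its negative represents a vector of the bipolar, that is, a
  -- critical direction.
  have hFpos : ∀ k ∈ polar (criticalCone f g x y), 0 ≤ F k := by
    intro k hk
    by_contra hneg
    have hneg := not_le.1 hneg
    have := hFb ((b / F k) • k) fun v hv => by
      rw [inner_smul_left]
      exact mul_nonpos_of_nonneg_of_nonpos (div_pos_of_neg_of_neg hb0 hneg).le (hk v hv)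
    rw [map_smul, smul_eq_mul, div_mul_cancel₀ _ hneg.ne] at this
    exact lt_irrefl _ this
  set u := -(InnerProductSpace.toDual ℝ (Euc m)).symm F with hu
  have hFu : ∀ k, inner ℝ u k = -F k := fun k => by
    rw [hu, inner_neg_left, InnerProductSpace.toDual_symm_apply]
  obtain ⟨l, hl, hle⟩ := h u (mem_criticalCone_of_forall_polar hy fun k hk => by
    rw [hFu]
    linarith [hFpos k hk])
  have h1 := hFa _ ⟨l, subset_convexHull ℝ S hl, rfl⟩
  have h2 : inner ℝ u (ξ + L l)
      = inner ℝ ξ u + inner ℝ l (fderiv ℝ (fderiv ℝ g) y ω u) := by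
    rw [inner_add_right, hL, ContinuousLinearMap.adjoint_inner_right, real_inner_comm,
      real_inner_comm l]
  rw [← h2, hFu] at hle
  linarith

variable {ξ ω : Euc m}

theorem AffineOrSlater.normal_inequality (h : AffineOrSlater g)
    (hν : -gradY f x y ∈ limitingNormalCone (lowerFeasible g) y)
    (hξω : WithLp.toLp 2 (ξ, ω) ∈ regularNormalCone (gph (limitingNormalCone (lowerFeasible g)))
      (WithLp.toLp 2 (y, -gradY f x y)))
    (hg : ContDiff ℝ 2 g)
    {v u : Euc m} {l : Euc r}
    (hv : v ∈ criticalCone f g x y) (hl : l ∈ dirMultipliers f g x y v)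
    (hu : u ∈ polar (criticalCone f g x y)) (huv : inner ℝ u v = 0) :
    inner ℝ ξ v + inner ℝ l (fderiv ℝ (fderiv ℝ g) y ω v) + inner ℝ ω u ≤ 0 := by
  have := hξω.2 _ (h.mem_tangentCone_gph hg hν hv hl hu huv)
  rw [WithLp.prod_inner_apply] at this
  simp only [inner_add_right, inner_hessG hg] at this
  rw [snd_fderiv_comm hg]
  linarith

theorem AffineOrSlater.normal_inequality_zero (h : AffineOrSlater g)
    (hν : -gradY f x y ∈ limitingNormalCone (lowerFeasible g) y)
    (hξω : WithLp.toLp 2 (ξ, ω) ∈ regularNormalCone (gph (limitingNormalCone (lowerFeasible g)))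
      (WithLp.toLp 2 (y, -gradY f x y)))
    (hg : ContDiff ℝ 2 g)
    {v : Euc m} {l : Euc r}
    (hv : v ∈ criticalCone f g x y) (hl : l ∈ dirMultipliers f g x y v) :
    inner ℝ ξ v + inner ℝ l (fderiv ℝ (fderiv ℝ g) y ω v) ≤ 0 := by
  simpa using h.normal_inequality hν hξω hg hv hl (u := 0) (fun v _ => by simp) (by simp)

theorem AffineOrSlater.normal_mem_criticalCone (h : AffineOrSlater g)
    (hν : -gradY f x y ∈ limitingNormalCone (lowerFeasible g) y)
    (hξω : WithLp.toLp 2 (ξ, ω) ∈ regularNormalCone (gph (limitingNormalCone (lowerFeasible g)))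
      (WithLp.toLp 2 (y, -gradY f x y)))
    (hg : ContDiff ℝ 2 g) :
    ω ∈ criticalCone f g x y := by
  refine mem_criticalCone_of_forall_polar hν.1 fun u hu => ?_
  obtain ⟨l, hl, -⟩ := h.dirMultipliers_inter_extreme_nonempty hg hν 0
  simpa using h.normal_inequality hν hξω hg (zero_mem_criticalCone hν.1) hl hu (by simp)

/-- Both `v` and `-v` are critical and have the same directional multipliers, because the objective
is even in `v`. -/
theorem AffineOrSlater.normal_equality (h : AffineOrSlater g)
    (hν : -gradY f x y ∈ limitingNormalCone (lowerFeasible g) y)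
    (hξω : WithLp.toLp 2 (ξ, ω) ∈ regularNormalCone (gph (limitingNormalCone (lowerFeasible g)))
      (WithLp.toLp 2 (y, -gradY f x y)))
    (hg : ContDiff ℝ 2 g)
    {v : Euc m} {l : Euc r} (hv : v ∈ activeNullspace g y) (hl : l ∈ dirMultipliers f g x y v) :
    inner ℝ ξ v + inner ℝ l (fderiv ℝ (fderiv ℝ g) y ω v) = 0 := by
  refine le_antisymm (h.normal_inequality_zero hν hξω hg
    (h.mem_criticalCone_of_mem_activeNullspace hg hν hv) hl) ?_
  have := h.normal_inequality_zero hν hξω hg (h.mem_criticalCone_of_mem_activeNullspace hg hν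
    (neg_mem_activeNullspace hv)) ((dirMultipliers_neg hg v).symm ▸ hl)
  simp only [map_neg, inner_neg_right] at this
  linarith

theorem AffineOrSlater.normal_mem_setW (h : AffineOrSlater g)
    (hν : -gradY f x y ∈ limitingNormalCone (lowerFeasible g) y)
    (hξω : WithLp.toLp 2 (ξ, ω) ∈ regularNormalCone (gph (limitingNormalCone (lowerFeasible g)))
      (WithLp.toLp 2 (y, -gradY f x y)))
    (hg : ContDiff ℝ 2 g)
    {v : Euc m} (hv : v ∈ activeNullspace g y) : ω ∈ setW f g x y v := by
  refine ⟨h.normal_mem_criticalCone hν hξω hg, fun l₁ hl₁ l₂ hl₂ => ?_⟩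
  have h1 := h.normal_equality hν hξω hg hv hl₁
  have h2 := h.normal_equality hν hξω hg hv hl₂
  rw [inner_hessG hg, inner_sub_left, snd_fderiv_comm hg]
  linarith

/-- For a critical direction `u`, some extreme directional multiplier of `v` satisfies the
normality inequality at `u`. It is obtained by perturbing `v` in the direction `u`. -/
theorem AffineOrSlater.exists_extreme_le (h : AffineOrSlater g)
    (hν : -gradY f x y ∈ limitingNormalCone (lowerFeasible g) y)
    (hξω : WithLp.toLp 2 (ξ, ω) ∈ regularNormalCone (gph (limitingNormalCone (lowerFeasible g)))
      (WithLp.toLp 2 (y, -gradY f x y)))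
    (hg : ContDiff ℝ 2 g)
    {v u : Euc m} (hv : v ∈ activeNullspace g y) (hu : u ∈ criticalCone f g x y) :
    ∃ l ∈ dirMultipliers f g x y v ∩ extremeMultipliers f g x y,
      inner ℝ ξ u + inner ℝ l (fderiv ℝ (fderiv ℝ g) y ω u) ≤ 0 := by
  have hvK := h.mem_criticalCone_of_mem_activeNullspace hg hν hv
  set τ : ℕ → ℝ := fun k => 1 / ((k : ℝ) + 1) with hτ
  have hτpos : ∀ k, 0 < τ k := fun k => by simp only [hτ]; positivity
  have hτ0 : Tendsto τ atTop (𝓝 0) := tendsto_one_div_add_atTop_nhds_zero_nat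
  choose l hl hlE using fun k => h.dirMultipliers_inter_extreme_nonempty hg hν (v + τ k • u)
  -- Pigeonhole: one of the finitely many extreme points recurs as `v + τ k • u → v`. Maximality
  -- passes to the limit, so it is a directional multiplier of `v`.
  obtain ⟨l₀, hl₀E, hfreq⟩ : ∃ l₀ ∈ extremeMultipliers f g x y, ∃ᶠ k in atTop, l k = l₀ := by
    by_contra hcon
    push Not at hcon
    have := (eventually_all_finite (l := atTop) (p := fun l₀ k => ¬ l k = l₀)
      (finite_extremeMultipliers (f := f) (x := x) hν.1)).2 fun l₀ hl₀ => hcon l₀ hl₀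
    obtain ⟨k, hk⟩ := this.exists
    exact hk _ (hlE k) rfl
  have hl₀ : l₀ ∈ dirMultipliers f g x y v := by
    refine (mem_dirMultipliers_iff hg).2 ⟨hl₀E.1, fun l' hl' => ?_⟩
    by_contra hlt
    have hlt := not_le.1 hlt
    have hc : Continuous fun s : ℝ => inner ℝ l' (fderiv ℝ (fderiv ℝ g) y (v + s • u) (v + s • u))
        - inner ℝ l₀ (fderiv ℝ (fderiv ℝ g) y (v + s • u) (v + s • u)) := by fun_prop
    have hlim := (hc.tendsto 0).comp hτ0
    simp only [zero_smul, add_zero] at hlim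
    have hev := hlim.eventually (lt_mem_nhds (sub_pos.2 hlt))
    obtain ⟨k, hk, hk'⟩ := (hfreq.and_eventually hev).exists
    have := ((mem_dirMultipliers_iff hg).1 (hl k)).2 l' hl'
    rw [hk] at this
    simp only [Function.comp_apply] at hk'
    linarith
  refine ⟨l₀, ⟨hl₀, hl₀E⟩, ?_⟩
  obtain ⟨k, hk⟩ := hfreq.exists
  -- Subtracting the equality at `v` from the inequality at `v + τ k • u`, with the same multiplier,
  -- leaves `τ k` times the claim.
  have h1 := h.normal_equality hν hξω hg hv hl₀
  have h2 := h.normal_inequality_zero hν hξω hg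
    (add_mem_criticalCone hν.1 hvK (smul_mem_criticalCone hν.1 hu (hτpos k).le)) (hk ▸ hl k)
  simp only [map_add, map_smul, inner_add_right, inner_smul_right] at h2
  refine nonpos_of_mul_nonpos_right (a := τ k) ?_ (hτpos k)
  linarith

theorem AffineOrSlater.normal_mem_setL (h : AffineOrSlater g)
    (hν : -gradY f x y ∈ limitingNormalCone (lowerFeasible g) y)
    (hξω : WithLp.toLp 2 (ξ, ω) ∈ regularNormalCone (gph (limitingNormalCone (lowerFeasible g)))
      (WithLp.toLp 2 (y, -gradY f x y)))
    (hg : ContDiff ℝ 2 g)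
    {v : Euc m} (hv : v ∈ activeNullspace g y) : ξ ∈ setL f g x y v ω := by
  rw [setL]
  split_ifs with hK
  swap
  · exact mem_univ _
  suffices H : ∃ l ∈ tildeMultipliers f g x y v,
      ξ + hessG g l y ω ∈ polar (criticalCone f g x y) by
    obtain ⟨l, hl, hk⟩ := H
    exact ⟨l, hl, _, hk, by abel⟩
  have hfin := finite_extremeMultipliers (f := f) (x := x) hν.1
  by_cases hv0 : v = 0
  -- At `v = 0` each nonzero `u` brings its own extreme directional multiplier. For `u = 0` any
  -- nonzero critical direction serves, since the inequality is then trivial.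
  · rw [tildeMultipliers, if_neg (not_not.2 hv0)]
    obtain ⟨u₀, hu₀, hu₀0⟩ : ∃ u ∈ criticalCone f g x y, u ≠ 0 := by
      by_contra hcon
      push Not at hcon
      exact hK (Subset.antisymm hcon (by simpa using zero_mem_criticalCone hν.1))
    refine exists_mem_convexHull_add_mem_polar hg hν.1
      (hfin.subset (iUnion₂_subset fun u _ => inter_subset_right)) ξ ω fun u hu => ?_
    by_cases hu0 : u = 0
    · obtain ⟨l, hl⟩ := h.dirMultipliers_inter_extreme_nonempty hg hν u₀
      exact ⟨l, mem_biUnion (show u₀ ∈ {u | _} from ⟨hu₀, hu₀0⟩) hl, by simp [hu0]⟩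
    · obtain ⟨l, hl⟩ := h.dirMultipliers_inter_extreme_nonempty hg hν u
      exact ⟨l, mem_biUnion (show u ∈ {u | _} from ⟨hu, hu0⟩) hl,
        h.normal_inequality_zero hν hξω hg hu hl.1⟩
  · rw [tildeMultipliers, if_pos hv0]
    exact exists_mem_convexHull_add_mem_polar hg hν.1 (hfin.subset inter_subset_right) ξ ω
      fun u hu => h.exists_extreme_le hν hξω hg hv hu

end Normals

/-! ### S-stationarity from calmness and the generalized LICQ. -/

section Stationarity

variable {n m r : ℕ}

instance continuousSMul_euc₂ : ContinuousSMul ℝ (Euc₂ n m) :=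
  have : IsBoundedSMul ℝ (Euc₂ n m) := NormedSpace.toIsBoundedSMul
  IsBoundedSMul.continuousSMul

theorem zero_mem_tangentCone {E : Type*} [NormedAddCommGroup E] [InnerProductSpace ℝ E]
    {Ω : Set E} {z : E} (hz : z ∈ Ω) : (0 : E) ∈ tangentCone Ω z :=
  ⟨fun k => 1 / ((k : ℝ) + 1), fun _ => 0, fun k => by positivity,
    tendsto_one_div_add_atTop_nhds_zero_nat, tendsto_const_nhds, fun k => by simpa using hz⟩

theorem tendsto_difference_quotient {E G : Type*} [NormedAddCommGroup E] [NormedSpace ℝ E]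
    [NormedAddCommGroup G] [NormedSpace ℝ G] {Φ : E → G} {Φ' : E →L[ℝ] G} {z : E}
    (h : HasFDerivAt Φ Φ' z) {t : ℕ → ℝ} {u' : ℕ → E} {u : E} (htpos : ∀ k, 0 < t k)
    (ht : Tendsto t atTop (𝓝 0)) (hu : Tendsto u' atTop (𝓝 u)) :
    Tendsto (fun k => (t k)⁻¹ • (Φ (z + t k • u' k) - Φ z)) atTop (𝓝 (Φ' u)) := by
  refine h.hasFDerivWithinAt.lim (s := univ) ?_ (Eventually.of_forall fun _ => mem_univ _) ?_
  · simpa using ht.smul hu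
  · refine hu.congr fun k => ?_
    rw [inv_smul_smul₀ (htpos k).ne']

theorem nonneg_of_isLocalMinOn {E : Type*} [NormedAddCommGroup E] [InnerProductSpace ℝ E]
    {φ : E → ℝ} {φ' : E →L[ℝ] ℝ} {Ω : Set E} {z u : E} (hφ : HasFDerivAt φ φ' z)
    (hmin : IsLocalMinOn φ Ω z) (hu : u ∈ tangentCone Ω z) : 0 ≤ φ' u := by
  obtain ⟨t, u', htpos, ht, hu', hmem⟩ := hu
  refine ge_of_tendsto (tendsto_difference_quotient hφ htpos ht hu') ?_
  have hz : Tendsto (fun k => z + t k • u' k) atTop (𝓝[Ω] z) := by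
    refine tendsto_nhdsWithin_iff.2 ⟨?_, Eventually.of_forall hmem⟩
    simpa using tendsto_const_nhds.add (ht.smul hu')
  filter_upwards [hz.eventually hmin] with k hk
  exact mul_nonneg (inv_pos.2 (htpos k)).le (sub_nonneg.2 hk)

/-- The polar of the preimage of `T` under `A` is the image of the polar of `T` under the adjoint
of `A` if the range of `A` and the linearity space of `T` span the whole space. -/
theorem exists_mem_polar_of_range_sup_linearitySpace {E G : Type*}
    [NormedAddCommGroup E] [InnerProductSpace ℝ E]
    [NormedAddCommGroup G] [InnerProductSpace ℝ G] [FiniteDimensional ℝ G]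
    (A : E →L[ℝ] G) {T : Set G} (h0 : (0 : G) ∈ T)
    (htop : LinearMap.range A.toLinearMap ⊔ linearitySpace T = ⊤) (φ : E →L[ℝ] ℝ)
    (hφ : ∀ u, A u ∈ T → 0 ≤ φ u) :
    ∃ η ∈ polar T, ∀ u, inner ℝ η (A u) = -φ u := by
  have : CompleteSpace G := FiniteDimensional.complete ℝ G
  set S : E × linearitySpace T →ₗ[ℝ] G := A.toLinearMap.coprod (linearitySpace T).subtype with hS
  have hSsurj : LinearMap.range S = ⊤ := by
    rw [hS, LinearMap.range_coprod, Submodule.range_subtype, htop]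
  obtain ⟨R, hR⟩ := S.exists_rightInverse_of_surjective hSsurj
  -- If `A u + l = 0`, then `A u` and `A (-u)` are in the linearity space, hence in `T` because `0 ∈
  -- T`. Both signs give `φ u = 0`, so `-φ` factors through the surjection `S`.
  have hker : ∀ p, S p = 0 → φ p.1 = 0 := by
    rintro ⟨u, l, hl⟩ hp
    have hp : A u + l = 0 := hp
    have h1 := hφ u (by
      have := hl (-1) 0 h0
      rw [eq_neg_of_add_eq_zero_left hp]
      simpa using this)
    have h2 := hφ (-u) (by
      have := hl 1 0 h0
      rw [map_neg, eq_neg_of_add_eq_zero_left hp]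
      simpa using this)
    rw [map_neg] at h2
    change φ u = 0
    linarith
  set ψ : G →ₗ[ℝ] ℝ := -(φ.toLinearMap ∘ₗ LinearMap.fst ℝ _ _ ∘ₗ R) with hψ
  have hψS : ∀ p, ψ (S p) = -φ p.1 := by
    intro p
    have := hker (R (S p) - p) (by
      rw [map_sub, sub_eq_zero]
      exact LinearMap.congr_fun hR (S p))
    rw [Prod.fst_sub, map_sub] at this
    exact congrArg Neg.neg (sub_eq_zero.1 this)
  refine ⟨(InnerProductSpace.toDual ℝ G).symm (LinearMap.toContinuousLinearMap ψ),
    fun v hv => ?_, fun u => ?_⟩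
  · rw [InnerProductSpace.toDual_symm_apply, LinearMap.coe_toContinuousLinearMap']
    obtain ⟨⟨u, l, hl⟩, hp⟩ := LinearMap.range_eq_top.1 hSsurj v
    rw [← hp, hψS]
    refine neg_nonpos.2 (hφ u ?_)
    have hp : A u + l = v := hp
    have := hl (-1) v hv
    rwa [← hp, neg_one_smul, add_neg_cancel_right] at this
  · rw [InnerProductSpace.toDual_symm_apply, LinearMap.coe_toContinuousLinearMap']
    have := hψS (u, 0)
    simpa [hS] using this

theorem fderiv_eq_add_partial {G : Type*} [NormedAddCommGroup G] [NormedSpace ℝ G]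
    {Φ : Euc₂ n m → G} {x : Euc n} {y : Euc m} (h : DifferentiableAt ℝ Φ (WithLp.toLp 2 (x, y)))
    (u : Euc₂ n m) :
    fderiv ℝ Φ (WithLp.toLp 2 (x, y)) u = fderiv ℝ (fun x' => Φ (WithLp.toLp 2 (x', y))) x u.fst
      + fderiv ℝ (fun y' => Φ (WithLp.toLp 2 (x, y'))) y u.snd := by
  let e := (WithLp.prodContinuousLinearEquiv 2 ℝ (Euc n) (Euc m)).symm
  have h1 : HasFDerivAt (fun x' => Φ (WithLp.toLp 2 (x', y)))
      ((fderiv ℝ Φ (WithLp.toLp 2 (x, y))).comp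
        (e.toContinuousLinearMap.comp (ContinuousLinearMap.inl ℝ _ _))) x :=
    h.hasFDerivAt.comp x (e.hasFDerivAt.comp x (hasFDerivAt_prodMk_left x y))
  have h2 : HasFDerivAt (fun y' => Φ (WithLp.toLp 2 (x, y')))
      ((fderiv ℝ Φ (WithLp.toLp 2 (x, y))).comp
        (e.toContinuousLinearMap.comp (ContinuousLinearMap.inr ℝ _ _))) y :=
    h.hasFDerivAt.comp y (e.hasFDerivAt.comp y (hasFDerivAt_prodMk_right x y))
  rw [h1.fderiv, h2.fderiv]
  simp only [ContinuousLinearMap.comp_apply]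
  rw [← map_add, ← map_add]
  congr 1
  simp [e]
  rfl

variable {F f : Euc n → Euc m → ℝ} {g : Euc m → Euc r} {x : Euc n} {y : Euc m}

theorem hasFDerivAt_mapP {z : Euc₂ n m} {G' : Euc₂ n m →L[ℝ] Euc m}
    (hG : HasFDerivAt (fun z : Euc₂ n m => gradY f z.fst z.snd) G' z) :
    ∃ A : Euc₂ n m →L[ℝ] Euc₂ m m, HasFDerivAt (mapP f) A z ∧
      ∀ u, A u = WithLp.toLp 2 (u.snd, -G' u) := by
  let e := (WithLp.prodContinuousLinearEquiv 2 ℝ (Euc m) (Euc m)).symm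
  let s : Euc₂ n m →L[ℝ] Euc m := (ContinuousLinearMap.snd ℝ (Euc n) (Euc m)).comp
    (WithLp.prodContinuousLinearEquiv 2 ℝ (Euc n) (Euc m)).toContinuousLinearMap
  exact ⟨e.toContinuousLinearMap.comp (s.prod (-G')),
    e.hasFDerivAt.comp z (s.hasFDerivAt.prodMk hG.neg), fun u => rfl⟩

/-- Under the metric subregularity constraint qualification, directions of the linearized cone are
tangent to the feasible set. -/
theorem MSCQ.mem_tangentCone (h : MSCQ f g x y) {G' : Euc₂ n m →L[ℝ] Euc m}
    (hG : HasFDerivAt (fun z : Euc₂ n m => gradY f z.fst z.snd) G' (WithLp.toLp 2 (x, y)))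
    {u : Euc₂ n m} (hu : WithLp.toLp 2 (u.snd, -G' u) ∈
      tangentCone (gph (limitingNormalCone (lowerFeasible g)))
        (WithLp.toLp 2 (y, -gradY f x y))) :
    u ∈ tangentCone (perturbedFeasible f g 0) (WithLp.toLp 2 (x, y)) := by
  obtain ⟨-, V, hV, W, hW, κ, hκ, hcalm⟩ := h
  obtain ⟨t, d, htpos, ht, hd, hmem⟩ := hu
  set z : Euc₂ n m := WithLp.toLp 2 (x, y) with hz
  have hd1 : Tendsto (fun k => (d k).fst) atTop (𝓝 u.snd) :=
    ((WithLp.prod_continuous_ofLp 2 (Euc m) (Euc m)).fst.tendsto _).comp hd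
  have hd2 : Tendsto (fun k => (d k).snd) atTop (𝓝 (-G' u)) :=
    ((WithLp.prod_continuous_ofLp 2 (Euc m) (Euc m)).snd.tendsto _).comp hd
  -- The `y`-part follows the approximating graph direction exactly, so the normal from the graph is
  -- used unchanged and the residual `α k` is `o(t k)`.
  set U : ℕ → Euc₂ n m := fun k => WithLp.toLp 2 (u.fst, (d k).fst) with hU
  have hUlim : Tendsto U atTop (𝓝 u) :=
    ((WithLp.prod_continuous_toLp 2 (Euc n) (Euc m)).tendsto (u.fst, u.snd)).comp
      (tendsto_const_nhds.prodMk_nhds hd1)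
  set α : ℕ → Euc m := fun k => gradY f (z + t k • U k).fst (z + t k • U k).snd
    + (-gradY f x y + t k • (d k).snd) with hα
  have hmemα : ∀ k, z + t k • U k ∈ perturbedFeasible f g (α k) := fun k =>
    ⟨-gradY f x y + t k • (d k).snd, hmem k, rfl⟩
  have hαlim : Tendsto (fun k => (t k)⁻¹ • α k) atTop (𝓝 0) := by
    have := (tendsto_difference_quotient hG htpos ht hUlim).add hd2
    rw [add_neg_cancel] at this
    refine this.congr fun k => ?_
    have e : α k = (gradY f (z + t k • U k).fst (z + t k • U k).snd - gradY f z.fst z.snd)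
        + t k • (d k).snd := by
      change gradY f (z + t k • U k).fst (z + t k • U k).snd + (-gradY f x y + t k • (d k).snd)
        = (gradY f (z + t k • U k).fst (z + t k • U k).snd - gradY f x y) + t k • (d k).snd
      abel
    rw [e, smul_add, inv_smul_smul₀ (htpos k).ne']
  have hα0 : Tendsto α atTop (𝓝 0) := by
    have := ht.smul hαlim
    rw [smul_zero] at this
    exact this.congr fun k => smul_inv_smul₀ (htpos k).ne' _
  have hz0 : Tendsto (fun k => z + t k • U k) atTop (𝓝 z) := by
    simpa using tendsto_const_nhds.add (ht.smul hUlim)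
  obtain ⟨N, hN⟩ := eventually_atTop.1 ((hα0.eventually hV).and (hz0.eventually hW))
  choose z' hz' hdist using fun k =>
    hcalm (α (k + N)) (hN (k + N) (by omega)).1 _ ⟨hmemα (k + N), (hN (k + N) (by omega)).2⟩
  have hshift := tendsto_add_atTop_nat N
  refine ⟨fun k => t (k + N), fun k => (t (k + N))⁻¹ • (z' k - z), fun k => htpos _,
    ht.comp hshift, ?_, fun k => ?_⟩
  · have hdiff : Tendsto (fun k => (t (k + N))⁻¹ • (z' k - z) - U (k + N)) atTop (𝓝 0) := by
      refine squeeze_zero_norm (a := fun k => κ * ‖(t (k + N))⁻¹ • α (k + N)‖) (fun k => ?_) ?_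
      · have e : (t (k + N))⁻¹ • (z' k - z) - U (k + N)
            = -((t (k + N))⁻¹ • (z + t (k + N) • U (k + N) - z' k)) := by
          rw [← inv_smul_smul₀ (htpos (k + N)).ne' (U (k + N)), ← smul_sub, ← smul_neg,
            smul_inv_smul₀ (htpos (k + N)).ne']
          congr 1
          abel
        have h1 := hdist k
        rw [sub_zero] at h1
        have h2 : 0 ≤ ‖(t (k + N))⁻¹‖ := norm_nonneg _
        rw [e, norm_neg, norm_smul, norm_smul]
        calc _ ≤ ‖(t (k + N))⁻¹‖ * (κ * ‖α (k + N)‖) := by gcongr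
          _ = _ := by ring
      · simpa using ((hαlim.comp hshift).norm.const_mul κ)
    simpa using hdiff.add (hUlim.comp hshift)
  · rw [smul_inv_smul₀ (htpos _).ne', add_sub_cancel]
    exact hz' k

theorem exists_sStationaryWith
    (hF : ContDiff ℝ 1 (fun z : Euc₂ n m => F z.fst z.snd))
    (hf : ∀ x, ContDiff ℝ 2 (fun y => f x y))
    (hf' : ContDiff ℝ 1 (fun z : Euc₂ n m => gradY f z.fst z.snd))
    (hν : -gradY f x y ∈ limitingNormalCone (lowerFeasible g) y)
    (hmin : IsLocalMinimizerMPEC F f g x y) (hMSCQ : MSCQ f g x y)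
    (hLICQ : GeneralizedLICQ f g x y) : ∃ w, SStationaryWith F f g x y w := by
  set z : Euc₂ n m := WithLp.toLp 2 (x, y) with hz
  have hFd := (hF.differentiable (by norm_num)) z
  have hGd := (hf'.differentiable (by norm_num)) z
  obtain ⟨A, hA, hAu⟩ := hasFDerivAt_mapP hGd.hasFDerivAt
  have hgph : WithLp.toLp 2 (y, -gradY f x y) ∈ gph (limitingNormalCone (lowerFeasible g)) := hν
  rw [GeneralizedLICQ, hA.fderiv] at hLICQ
  obtain ⟨η, hη, hηA⟩ := exists_mem_polar_of_range_sup_linearitySpace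
    (E := Euc₂ n m) (G := Euc₂ m m) A (T := tangentCone (gph (limitingNormalCone (lowerFeasible g)))
      (WithLp.toLp 2 (y, -gradY f x y))) (zero_mem_tangentCone hgph) hLICQ
    (fderiv ℝ (fun z : Euc₂ n m => F z.fst z.snd) z)
    (fun u hu => by
      have hu' : A u ∈ tangentCone (gph (limitingNormalCone (lowerFeasible g)))
        (WithLp.toLp 2 (y, -gradY f x y)) := hu
      rw [hAu] at hu'
      exact nonneg_of_isLocalMinOn hFd.hasFDerivAt hmin.2
        (hMSCQ.mem_tangentCone hGd.hasFDerivAt hu'))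
  have key : ∀ (u : Euc n) (v : Euc m),
      inner ℝ η.fst v - inner ℝ η.snd (fderiv ℝ (fun x' => gradY f x' y) x u + hessYY f x y v)
        = -(inner ℝ u (gradX F x y) + inner ℝ v (gradY F x y)) := by
    intro u v
    have h1 := hηA (WithLp.toLp 2 (u, v))
    have h2 : fderiv ℝ (fun z : Euc₂ n m => F z.fst z.snd) z (WithLp.toLp 2 (u, v))
        = fderiv ℝ (fun x' => F x' y) x u + fderiv ℝ (fun y' => F x y') y v :=
      fderiv_eq_add_partial hFd _
    have h3 : fderiv ℝ (fun z : Euc₂ n m => gradY f z.fst z.snd) z (WithLp.toLp 2 (u, v))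
        = fderiv ℝ (fun x' => gradY f x' y) x u + hessYY f x y v :=
      fderiv_eq_add_partial hGd _
    rw [hAu, h2, h3] at h1
    rw [gradX, gradY, inner_gradient_eq, inner_gradient_eq, sub_eq_add_neg, ← inner_neg_right]
    exact h1
  -- The coderivative pairs `ξ` with `-w`, hence `w = -η.snd`. The two equations are `key` tested
  -- separately in `x` and in `y`.
  refine ⟨-η.snd, ?_, η.fst, ⟨hgph, ?_⟩, ?_⟩
  · refine ext_inner_left ℝ fun u => ?_
    have := key u 0
    rw [hessXY, map_neg, inner_add_right, inner_neg_right,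
      ContinuousLinearMap.adjoint_inner_right,
      real_inner_comm η.snd (fderiv ℝ (fun x' => gradY f x' y) x u)]
    simp only [map_zero, inner_zero_right, inner_zero_left, add_zero] at this ⊢
    linarith
  · rw [neg_neg]
    exact hη
  · refine ext_inner_left ℝ fun v => ?_
    have := key 0 v
    have hs := inner_hessian_comm (hf x) y v η.snd
    rw [map_neg, inner_add_right, inner_add_right, inner_neg_right, hessYY, hs]
    simp only [map_zero, inner_zero_right, inner_zero_left, zero_add, hessYY] at this ⊢
    rw [real_inner_comm v η.fst] at this
    linarith

end Stationarity

end Bilevel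

end

open Bilevel
theorem theorem6 {n m r : ℕ}
    (F f : Euc n → Euc m → ℝ) (g : Euc m → Euc r)
    (hF : ContDiff ℝ 1 (fun z : Euc₂ n m => F z.fst z.snd))
    (hf : ∀ x, ContDiff ℝ 2 (fun y => f x y))
    (hf' : ContDiff ℝ 1 (fun z : Euc₂ n m => gradY f z.fst z.snd))
    (hg : ContDiff ℝ 2 g) (hg' : AffineOrSlater g)
    (x : Euc n) (y : Euc m)
    (hmin : IsLocalMinimizerMPEC F f g x y)
    (hMSCQ : MSCQ f g x y)
    (hLICQ : GeneralizedLICQ f g x y) :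
    (∃ w, SStationaryWith F f g x y w) ∧
    ∀ w, SStationaryWith F f g x y w →
      (-w ∈ ⋂ v ∈ activeNullspace g y, setW f g x y v) ∧
      0 = gradX F x y + hessXY f x y w ∧
      ∃ ξ ∈ ⋂ v ∈ activeNullspace g y, setL f g x y v (-w),
        0 = gradY F x y + hessYY f x y w + ξ := by
  have hν : -gradY f x y ∈ limitingNormalCone (lowerFeasible g) y := by
    obtain ⟨ν, hν, h0⟩ := hmin.1
    rw [eq_neg_of_add_eq_zero_right h0.symm] at hν
    exact hν
  refine ⟨exists_sStationaryWith hF hf hf' hν hmin hMSCQ hLICQ, ?_⟩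
  rintro w ⟨hw, ξ, hξ, hξ0⟩
  exact ⟨mem_iInter₂.2 fun v hv => hg'.normal_mem_setW hν hξ hg hv, hw, ξ,
    mem_iInter₂.2 fun v hv => hg'.normal_mem_setL hν hξ hg hv, hξ0⟩
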